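/- **Theorem (iISS through Lyapunov-Razumikhin).** Let $n,m\in\mathbb N$ and $\Delta\ge 0$. Let $\mathcal X^n=C([-\Delta,0];\mathbb R^n)$ with the supremum norm $\|\cdot\|$, let $|\cdot|$ be the Euclidean norm, and let $\mathcal U^m$ be the set of Lebesgue measurable, locally essentially bounded functions $u:\mathbb R_{\ge 0}\to\mathbb R^m$. Let $F:\mathbb R^n\times\mathcal X^n\times\mathbb R^m\to\mathbb R^n$ be Lipschitz on bounded sets with $F(0,0,0)=0$, and consider the time-delay system $$\dot x(t)=F(x(t),x_t,u(t)),\qquad x_t(\tau):=x(t+\tau)\ \text{ for } \tau\in[-\Delta,0]. \tag{1}$$ For $x_0\in\mathcal X^n$ and $u\in\mathcal U^m$, a solution of (1) on $[0,T)$, $T\in(0,+\infty]$, is a continuous function $x:[-\Delta,T)\to\mathbb R^n$ that equals $x_0$ on $[-\Delta,0]$ and satisfies $x(t)=x_0(0)+\int_0^tF(x(\tau),x_\tau,u(\tau))\,d\tau$ for all $t\in[0,T)$. A continuous function $a:\mathbb R_{\ge0}\to\mathbb R_{\ge0}$ with $a(0)=0$ is of class $\mathcal N$ if it is non-decreasing,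 of class $\mathcal P$ if $a(s)>0$ for all $s>0$, of class $\mathcal K$ if it is of class $\mathcal P$ and strictly increasing, and of class $\mathcal K_\infty$ if it is of class $\mathcal K$ and $a(s)\to+\infty$ as $s\to+\infty$. A function $\beta:\mathbb R_{\ge0}\times\mathbb R_{\ge0}\to\mathbb R_{\ge0}$ is of class $\mathcal{KL}$ if $\beta(\cdot,t)\in\mathcal K$ for each $t\ge0$ and, for each $s\ge 0$, $\beta(s,\cdot)$ is continuous, non-increasing and tends to $0$ at $+\infty$. Assume that there exist a function $V\in C^1(\mathbb R^n;\mathbb R_{\ge0})$ that is positive definite ($V(0)=0$ and $V(x)>0$ for $x\ne0$) and radially unbounded ($V(x)\to+\infty$ as $|x|\to+\infty$), and functions $\alpha\in\mathcal P$, $\gamma\in\mathcal N$ and $\rho\in\mathcal K_\infty$ such that, for all $\phi\in\mathcal X^n$, $w\in\mathcal X^n$ and $v\in\mathbb R^m$, $$V(\phi(0))\ge\rho\Big(\max_{\tau\in[-\Delta,0]}V(w(\tau))\Big)\quad\Longrightarrow\quad\nabla V(\phi(0))^\top F(\phi(0),w,v)\le-\alpha(|\phi(0)|)+\gamma(|v|).$$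 Suppose moreover that there exists $\kappa\in\mathcal K_\infty$ such that $\rho(s)+\kappa(\rho(s))\le s$ for all $s\ge0$. Then (1) is integral input-to-state stable (iISS): there exist $\beta\in\mathcal{KL}$ and $\eta,\mu\in\mathcal N$ such that, for all $x_0\in\mathcal X^n$ and all $u\in\mathcal U^m$, the solution of (1) exists on $[0,+\infty)$, and every solution of (1) with initial state $x_0$ and input $u$ satisfies $$|x(t)|\le\beta(\|x_0\|,t)+\eta\Big(\int_0^t\mu(|u(\tau)|)\,d\tau\Big)$$ for all $t\ge0$ in its interval of existence. -/

import Mathlib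

open MeasureTheory Set Filter Topology
open scoped NNReal

namespace TimeDelay

/-! Comparison functions. They are maps from `[0, ∞)` to `[0, ∞)`, represented by functions
`ℝ → ℝ` of which only the restriction to `[0, ∞)` matters. -/

/-- Class `𝒩`: continuous, non-decreasing, zero at zero. -/
structure ClassN (a : ℝ → ℝ) : Prop where
  continuousOn : ContinuousOn a (Ici 0)
  monotoneOn : MonotoneOn a (Ici 0)
  map_zero : a 0 = 0

/-- Class `𝒫`: continuous, zero at zero, positive elsewhere. -/
structure ClassP (a : ℝ → ℝ) : Prop where
  continuousOn : ContinuousOn a (Ici 0)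
  map_zero : a 0 = 0
  pos : ∀ s, 0 < s → 0 < a s

/-- Class `𝒦`: class `𝒫` and (strictly) increasing. -/
structure ClassK (a : ℝ → ℝ) : Prop extends ClassP a where
  strictMonoOn : StrictMonoOn a (Ici 0)

/-- Class `𝒦∞`: class `𝒦` and unbounded. -/
structure ClassKInf (a : ℝ → ℝ) : Prop extends ClassK a where
  tendsto_atTop : Tendsto a atTop atTop

/-- Class `ℒ`: continuous, non-increasing, tending to zero at infinity
(and hence nonnegative on `[0, ∞)`). -/
structure ClassL (l : ℝ → ℝ) : Prop where
  continuousOn : ContinuousOn l (Ici 0)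
  antitoneOn : AntitoneOn l (Ici 0)
  tendsto_zero : Tendsto l atTop (𝓝 0)

/-- Class `𝒦ℒ`: class `𝒦` in the first argument, class `ℒ` in the second one. -/
structure ClassKL (b : ℝ → ℝ → ℝ) : Prop where
  classK : ∀ t, 0 ≤ t → ClassK (fun s => b s t)
  classL : ∀ s, 0 ≤ s → ClassL (fun t => b s t)

/-- `ℝⁿ` with the Euclidean norm. -/
abbrev Vec (n : ℕ) : Type := EuclideanSpace ℝ (Fin n)

/-- The space `𝒳ⁿ` of continuous functions from `[-Δ, 0]` to `ℝⁿ`, with the supremum norm. -/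
abbrev Hist (Δ : ℝ≥0) (n : ℕ) : Type := C(Icc (-(Δ : ℝ)) 0, Vec n)

/-- The value `φ(0)` of `φ ∈ 𝒳ⁿ`. -/
def Hist.now {Δ : ℝ≥0} {n : ℕ} (φ : Hist Δ n) : Vec n :=
  φ ⟨0, neg_nonpos.mpr Δ.coe_nonneg, le_refl 0⟩

/-- The history segment `x_t ∈ 𝒳ⁿ`, `x_t(τ) = x(t + τ)` for `τ ∈ [-Δ, 0]`. It is used only where `x`
is continuous on `[t - Δ, t]` (otherwise it takes the default value `0`). -/
noncomputable def histSegment {n : ℕ} (Δ : ℝ≥0) (x : ℝ → Vec n) (t : ℝ) : Hist Δ n :=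
  ContinuousMap.mkD (fun τ : Icc (-(Δ : ℝ)) 0 => x (t + τ)) 0

/-- The set `𝒰ᵐ` of inputs on `[0, ∞)`: Lebesgue measurable and locally essentially bounded.
The values at negative times are irrelevant. -/
structure IsInput {m : ℕ} (u : ℝ → Vec m) : Prop where
  aestronglyMeasurable : AEStronglyMeasurable u (volume.restrict (Ici 0))
  locallyEssBounded : ∀ T : ℝ, ∃ C : ℝ, ∀ᵐ t ∂(volume.restrict (Icc 0 T)), ‖u t‖ ≤ C

/-- `x` is a solution on `[0, T)`, `T ∈ (0, ∞]`, of `ẋ(t) = f(x_t, u(t))` with initial state `x₀`: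
it is continuous on `[-Δ, T)`, equals `x₀` on `[-Δ, 0]` and satisfies
`x(t) = x₀(0) + ∫₀ᵗ f(x_τ, u(τ)) dτ` for all `t ∈ [0, T)`. Values outside `[-Δ, T)` are
irrelevant. -/
structure IsSolution {Δ : ℝ≥0} {n m : ℕ} (f : Hist Δ n → Vec m → Vec n)
    (x₀ : Hist Δ n) (u : ℝ → Vec m) (T : EReal) (x : ℝ → Vec n) : Prop where
  pos : 0 < T
  continuousOn : ContinuousOn x {t : ℝ | -(Δ : ℝ) ≤ t ∧ (t : EReal) < T}
  initial : ∀ τ : Icc (-(Δ : ℝ)) 0, x τ = x₀ τ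
  integrable : ∀ t : ℝ, 0 ≤ t → (t : EReal) < T →
    IntervalIntegrable (fun τ => f (histSegment Δ x τ) (u τ)) volume 0 t
  integral_eq : ∀ t : ℝ, 0 ≤ t → (t : EReal) < T →
    x t = x₀.now + ∫ τ in (0 : ℝ)..t, f (histSegment Δ x τ) (u τ)

/-- Integral input-to-state stability of `ẋ(t) = f(x_t, u(t))`. For every initial state and every
input the solution exists on `[0, ∞)`, and every solution, on whatever interval of existence,
satisfies the iISS estimate. -/
def IsIISS {Δ : ℝ≥0} {n m : ℕ} (f : Hist Δ n → Vec m → Vec n) : Prop :=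
  ∃ (β : ℝ → ℝ → ℝ) (η μ : ℝ → ℝ), ClassKL β ∧ ClassN η ∧ ClassN μ ∧
    ∀ (x₀ : Hist Δ n) (u : ℝ → Vec m), IsInput u →
      (∃ x : ℝ → Vec n, IsSolution f x₀ u ⊤ x) ∧
      ∀ (T : EReal) (x : ℝ → Vec n), IsSolution f x₀ u T x →
        ∀ t : ℝ, 0 ≤ t → (t : EReal) < T →
          ‖x t‖ ≤ β ‖x₀‖ t + η (∫ τ in (0 : ℝ)..t, μ ‖u τ‖)

/-- `F : ℝⁿ × 𝒳ⁿ × ℝᵐ → ℝⁿ` is Lipschitz on bounded sets. -/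
def LipschitzOnBoundedSets {Δ : ℝ≥0} {n m : ℕ} (F : Vec n → Hist Δ n → Vec m → Vec n) : Prop :=
  ∀ r : ℝ, 0 < r → ∃ L : ℝ, 0 < L ∧
    ∀ (x₁ x₂ : Vec n) (φ₁ φ₂ : Hist Δ n) (v₁ v₂ : Vec m),
      ‖x₁‖ ≤ r → ‖x₂‖ ≤ r → ‖φ₁‖ ≤ r → ‖φ₂‖ ≤ r → ‖v₁‖ ≤ r → ‖v₂‖ ≤ r →
        ‖F x₁ φ₁ v₁ - F x₂ φ₂ v₂‖ ≤ L * (‖x₁ - x₂‖ + ‖φ₁ - φ₂‖ + ‖v₁ - v₂‖)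

/-- The right-hand side `(φ, v) ↦ F(φ(0), φ, v)` of `ẋ(t) = F(x(t), x_t, u(t))`. -/
def closedLoop {Δ : ℝ≥0} {n m : ℕ} (F : Vec n → Hist Δ n → Vec m → Vec n) :
    Hist Δ n → Vec m → Vec n :=
  fun φ v => F φ.now φ v

end TimeDelay

/-!
Write `v t = V (x t)` for the Lyapunov function along a solution and `E t = ∫₀ᵗ γ |u|` for the
energy supplied by the input. Wherever `v t` is at least `ρ` of the maximum of `v` over the delay
window, `v - E` decreases, at a rate bounded below on each region `p ≤ v ≤ q` with `p > 0`,
uniformly over all solutions (`IsSolution.razumikhinDecay`); this uses that `V ∘ x` is Lipschitz on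
compact intervals, hence the integral of its derivative. The rest of the stability proof is about
such scalar functions `v`.

* Since `ρ s < s` for `s > 0`, the Razumikhin condition would hold just before a point where `v - E`
  reached a maximum above the initial bound, so `v - E` would decrease towards its maximum, which is
  absurd. So `v t ≤ max v₀ + E t`, with `v₀` the initial segment of `v`
  (`RazumikhinDecay.le_add_energy`).
* Fix the final time `T` and treat `G = E T` as a constant. If `v ≤ N` from some time on, then
  `v ≥ ρ N` already implies the Razumikhin condition, so after a time controlled by `N` and `G`
  the bound improves to `v ≤ ρ N + G` (`RazumikhinDecay.le_apply_add_energy`). The gain margin gives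
  `ρ N + G ≤ N - (κ (ρ N) - G)`, and `κ (ρ N)` exceeds `2 G` for `N` above a level `σ G` of class
  `𝒩`. Iteration brings `v` below `σ G + ε` in a time that depends only on `ε` and a bound on the
  initial state, unless `G` exceeds that bound, in which case the first estimate gives `v T ≤ 2 G`
  (`exists_time_le_of_razumikhinDecay`).
* The excess of `v` over `σ G + 2 G` is thus bounded in terms of the initial state, small for small
  initial states, and small after a uniform time. A family of numbers with these three properties
  has a majorant of class `𝒦ℒ` (`exists_classKL_majorant`), which gives `β`.

For global existence, the first estimate is an a priori bound for all solutions. The equation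
truncated outside that bound is globally Lipschitz in the state, so it has a global solution by the
contraction principle in a weighted norm (`exists_primitive_of_causal_lipschitz`), and this solution
never reaches the region where the truncation acts (`exists_isSolution_top`).
-/

namespace TimeDelay

/-! ### Majorants of class `𝒦` and `𝒦ℒ` -/

/-- The ramp equal to `0` on `(-∞, 0]`, to the identity on `[0, 1]` and to `1` on `[1, ∞)`. -/
noncomputable def ramp (x : ℝ) : ℝ := min 1 (max 0 x)

lemma ramp_nonneg (x : ℝ) : 0 ≤ ramp x := le_min zero_le_one (le_max_left _ _)

lemma ramp_le_one (x : ℝ) : ramp x ≤ 1 := min_le_left _ _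

lemma ramp_mono : Monotone ramp := fun _ _ h => min_le_min_left _ (max_le_max_left _ h)

lemma ramp_of_one_le {x : ℝ} (h : 1 ≤ x) : ramp x = 1 :=
  min_eq_left (h.trans (le_max_right _ _))

lemma ramp_of_nonpos {x : ℝ} (h : x ≤ 0) : ramp x = 0 := by
  rw [ramp, max_eq_left h, min_eq_right zero_le_one]

lemma ramp_le_add (x y : ℝ) : ramp x ≤ ramp y + |x - y| := by
  have := le_abs_self (x - y)
  have := abs_nonneg (x - y)
  unfold ramp
  rcases le_total 0 x with hx | hx <;> rcases le_total 0 y with hy | hy <;>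
    simp only [max_eq_left, max_eq_right, hx, hy] <;>
    rcases le_total 1 x with hx1 | hx1 <;> rcases le_total 1 y with hy1 | hy1 <;>
    simp [hx1, hy1] <;> linarith

/-- The suprema of two families at distance at most `K` are at distance at most `K`; the empty
family, with supremum `0`, is allowed. -/
lemma abs_iSup_sub_iSup_le {ι : Type*} {f g : ι → ℝ} {K : ℝ} (hK : 0 ≤ K)
    (hf : BddAbove (range f)) (hg : BddAbove (range g))
    (hfg : ∀ i, f i ≤ g i + K) (hgf : ∀ i, g i ≤ f i + K) :
    |(⨆ i, f i) - ⨆ i, g i| ≤ K := by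
  rcases isEmpty_or_nonempty ι with _ | _
  · simpa [Real.iSup_of_isEmpty] using hK
  · rw [abs_le]
    constructor
    · have : (⨆ i, g i) ≤ (⨆ i, f i) + K :=
        ciSup_le fun i => (hgf i).trans (add_le_add_left (le_ciSup hf i) K)
      linarith
    · have : (⨆ i, f i) ≤ (⨆ i, g i) + K :=
        ciSup_le fun i => (hfg i).trans (add_le_add_left (le_ciSup hg i) K)
      linarith

/-- Continuity at a point from a Lipschitz estimate near this point. -/
lemma continuousAt_of_abs_sub_le {f : ℝ → ℝ} {a K : ℝ}
    (h : ∀ᶠ x in 𝓝 a, |f x - f a| ≤ K * |x - a|) : ContinuousAt f a := by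
  rw [ContinuousAt, tendsto_iff_dist_tendsto_zero]
  have hK : ContinuousAt (fun x : ℝ => K * |x - a|) a := by fun_prop
  exact squeeze_zero' (Eventually.of_forall fun _ => dist_nonneg) h
    (by simpa [ContinuousAt] using hK)

/-- The weight, at the point `(r, t)`, of a datum at `(s, τ)`: it is `1` if `0 < s ≤ r` and
`t ≤ τ`, and vanishes if `2 * r ≤ s` or `τ + 1 ≤ t`. It also vanishes for `s = 0`, where division by
zero yields `ramp (-1) = 0`. -/
noncomputable def klWeight (s τ r t : ℝ) : ℝ := ramp (2 * r / s - 1) * ramp (1 + τ - t)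

lemma klWeight_nonneg (s τ r t : ℝ) : 0 ≤ klWeight s τ r t :=
  mul_nonneg (ramp_nonneg _) (ramp_nonneg _)

lemma klWeight_le_one (s τ r t : ℝ) : klWeight s τ r t ≤ 1 :=
  mul_le_one₀ (ramp_le_one _) (ramp_nonneg _) (ramp_le_one _)

lemma klWeight_mono {s r r' : ℝ} (hs : 0 ≤ s) (h : r ≤ r') (τ t : ℝ) :
    klWeight s τ r t ≤ klWeight s τ r' t := by
  refine mul_le_mul_of_nonneg_right (ramp_mono ?_) (ramp_nonneg _)
  have : 2 * r / s ≤ 2 * r' / s := by gcongr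
  linarith

lemma klWeight_anti {t t' : ℝ} (h : t ≤ t') (s τ r : ℝ) :
    klWeight s τ r t' ≤ klWeight s τ r t :=
  mul_le_mul_of_nonneg_left (ramp_mono (by linarith)) (ramp_nonneg _)

lemma klWeight_eq_zero {s r : ℝ} (hs : 0 ≤ s) (h : 2 * r < s) (τ t : ℝ) :
    klWeight s τ r t = 0 := by
  have : 2 * r / s ≤ 1 := div_le_one_of_le₀ h.le hs
  rw [klWeight, ramp_of_nonpos (by linarith), zero_mul]

lemma klWeight_eq_zero_of_add_one_le {τ t : ℝ} (h : τ + 1 ≤ t) (s r : ℝ) : klWeight s τ r t = 0 := by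
  rw [klWeight, ramp_of_nonpos (x := 1 + τ - t) (by linarith), mul_zero]

lemma klWeight_self {s : ℝ} (hs : 0 < s) (τ : ℝ) : klWeight s τ s τ = 1 := by
  have : 2 * s / s = 2 := by field_simp
  rw [klWeight, this, ramp_of_one_le (by norm_num), ramp_of_one_le (by linarith), mul_one]

lemma klWeight_le_time (s τ r t t' : ℝ) :
    klWeight s τ r t ≤ klWeight s τ r t' + |t - t'| := by
  have h := ramp_le_add (1 + τ - t) (1 + τ - t')
  have h1 : |1 + τ - t - (1 + τ - t')| = |t - t'| := by
    rw [abs_sub_comm]; congr 1; ring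
  rw [h1] at h
  unfold klWeight
  have h2 := ramp_nonneg (2 * r / s - 1)
  have h3 := ramp_le_one (2 * r / s - 1)
  have h4 := abs_nonneg (t - t')
  calc _ ≤ ramp (2 * r / s - 1) * (ramp (1 + τ - t') + |t - t'|) :=
        mul_le_mul_of_nonneg_left h h2
    _ ≤ _ := by rw [mul_add]; gcongr; exact mul_le_of_le_one_left h4 h3

lemma klWeight_le_size {s p r r' : ℝ} (hs : 0 ≤ s) (hp : 0 < p) (hr' : p ≤ r')
    (τ t : ℝ) : klWeight s τ r t ≤ klWeight s τ r' t + 2 / p * |r - r'| := by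
  have h2 := ramp_nonneg (1 + τ - t)
  have h3 := ramp_le_one (1 + τ - t)
  have hK : 0 ≤ 2 / p * |r - r'| := by positivity
  have key : ramp (2 * r / s - 1) ≤ ramp (2 * r' / s - 1) + 2 / p * |r - r'| := by
    rcases hs.eq_or_lt with rfl | hs
    · simpa using hK
    rcases le_total s p with hsp | hsp
    · have : 1 ≤ 2 * r' / s - 1 := by
        have : 2 ≤ 2 * r' / s := by rw [le_div_iff₀ hs]; linarith
        linarith
      rw [ramp_of_one_le this]
      linarith [ramp_le_one (2 * r / s - 1)]
    · refine (ramp_le_add _ (2 * r' / s - 1)).trans (add_le_add_right ?_ _)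
      have : 2 * r / s - 1 - (2 * r' / s - 1) = 2 / s * (r - r') := by ring
      rw [this, abs_mul, abs_of_nonneg (by positivity)]
      gcongr
  unfold klWeight
  calc _ ≤ (ramp (2 * r' / s - 1) + 2 / p * |r - r'|) * ramp (1 + τ - t) :=
        mul_le_mul_of_nonneg_right key h2
    _ ≤ _ := by rw [add_mul]; exact add_le_add_right (mul_le_of_le_one_right hK h3) _

/-- A family of data `d i` at the points `(s i, τ i)` of the quadrant is dominated by a function of
class `𝒦ℒ` as soon as it is bounded for bounded `s`, small for small `s`, and small for large `τ`
locally uniformly in `s`. The dominating function is the supremum of the data, weighted so that it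
is continuous. -/
theorem exists_classKL_majorant {ι : Type*} (s τ d : ι → ℝ) (hs : ∀ i, 0 ≤ s i)
    (hbdd : ∀ R, ∃ C, ∀ i, s i ≤ R → d i ≤ C)
    (hsmall : ∀ ε, 0 < ε → ∃ δ, 0 < δ ∧ ∀ i, s i ≤ δ → d i ≤ ε)
    (hlim : ∀ R ε, 0 < ε → ∃ T, ∀ i, s i ≤ R → T ≤ τ i → d i ≤ ε) :
    ∃ β : ℝ → ℝ → ℝ, ClassKL β ∧ ∀ i, d i ≤ β (s i) (τ i) := by
  set e : ι → ℝ := fun i => max (d i) 0 with he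
  have he0 : ∀ i, 0 ≤ e i := fun i => le_max_right _ _
  set f : ℝ → ℝ → ι → ℝ := fun r t i => e i * klWeight (s i) (τ i) r t with hf
  have hf0 : ∀ r t i, 0 ≤ f r t i := fun r t i => mul_nonneg (he0 i) (klWeight_nonneg _ _ _ _)
  set g : ℝ → ℝ → ℝ := fun r t => ⨆ i, f r t i with hg
  have hg0 : ∀ r t, 0 ≤ g r t := fun r t => Real.iSup_nonneg (hf0 r t)
  -- only the data with `s i ≤ 2 * r` contribute to the supremum at `r`
  have hfle : ∀ r t i C, 0 ≤ C → (s i ≤ 2 * r → e i ≤ C) → f r t i ≤ C := by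
    intro r t i C hC h
    by_cases hi : s i ≤ 2 * r
    · exact (mul_le_of_le_one_right (he0 i) (klWeight_le_one _ _ _ _)).trans (h hi)
    · simp only [hf]
      rwa [klWeight_eq_zero (hs i) (not_le.1 hi), mul_zero]
  have hbdd' : ∀ R, ∃ C, 0 ≤ C ∧ ∀ i, s i ≤ R → e i ≤ C := fun R => by
    obtain ⟨C, hC⟩ := hbdd R
    exact ⟨max C 0, le_max_right _ _, fun i hi => max_le_max_right _ (hC i hi)⟩
  have hfb : ∀ r t, BddAbove (range (f r t)) := fun r t => by
    obtain ⟨C, hC0, hC⟩ := hbdd' (2 * r)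
    exact ⟨C, by rintro _ ⟨i, rfl⟩; exact hfle r t i C hC0 (hC i)⟩
  have hgle : ∀ r t C, 0 ≤ C → (∀ i, f r t i ≤ C) → g r t ≤ C :=
    fun r t C hC h => Real.iSup_le h hC
  have hgmono : ∀ t, Monotone fun r => g r t := fun t r r' hr =>
    hgle _ _ _ (hg0 _ _) fun i => le_ciSup_of_le (hfb r' t) i
      (mul_le_mul_of_nonneg_left (klWeight_mono (hs i) hr _ _) (he0 i))
  have hganti : ∀ r, Antitone fun t => g r t := fun r t t' ht =>
    hgle _ _ _ (hg0 _ _) fun i => le_ciSup_of_le (hfb r t) i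
      (mul_le_mul_of_nonneg_left (klWeight_anti ht _ _ _) (he0 i))
  have hgzero : ∀ t, g 0 t = 0 := fun t => by
    refine le_antisymm (hgle _ _ _ le_rfl fun i => ?_) (hg0 _ _)
    simp [hf, klWeight, ramp_of_nonpos]
  have hgsmall : ∀ ε, 0 < ε → ∃ δ, 0 < δ ∧ ∀ r t, r ≤ δ → g r t ≤ ε := fun ε hε => by
    obtain ⟨δ, hδ, h⟩ := hsmall ε hε
    refine ⟨δ / 2, by positivity, fun r t hr => hgle _ _ _ hε.le fun i => ?_⟩
    exact hfle r t i ε hε.le fun hi => max_le (h i (by linarith)) hε.le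
  have hgcr : ∀ t, ContinuousOn (fun r => g r t) (Ici 0) := by
    intro t r hr
    rcases (mem_Ici.1 hr).eq_or_lt with rfl | hr
    · refine ContinuousAt.continuousWithinAt ?_
      rw [Metric.continuousAt_iff]
      intro ε hε
      obtain ⟨δ, hδ, h⟩ := hgsmall (ε / 2) (by positivity)
      refine ⟨δ, hδ, fun {r} hr => ?_⟩
      rw [hgzero, Real.dist_eq, sub_zero, abs_of_nonneg (hg0 _ _)]
      rw [Real.dist_eq, sub_zero] at hr
      linarith [h r t ((le_abs_self _).trans hr.le)]
    · obtain ⟨C, hC0, hC⟩ := hbdd' (4 * r)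
      refine (continuousAt_of_abs_sub_le (K := C * (2 / (r / 2))) ?_).continuousWithinAt
      filter_upwards [Icc_mem_nhds (show r / 2 < r by linarith) (show r < 2 * r by linarith)]
        with r' hr'
      have key : ∀ r₁ ∈ Icc (r / 2) (2 * r), ∀ r₂ ∈ Icc (r / 2) (2 * r), ∀ i,
          f r₁ t i ≤ f r₂ t i + C * (2 / (r / 2)) * |r₁ - r₂| := by
        intro r₁ h₁ r₂ h₂ i
        by_cases hi : s i ≤ 4 * r
        · have := klWeight_le_size (r := r₁) (hs i) (half_pos hr) h₂.1 (τ i) t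
          have h3 : 0 ≤ 2 / (r / 2) * |r₁ - r₂| := by positivity
          calc f r₁ t i ≤ e i * (klWeight (s i) (τ i) r₂ t + 2 / (r / 2) * |r₁ - r₂|) :=
                mul_le_mul_of_nonneg_left this (he0 i)
            _ = f r₂ t i + e i * (2 / (r / 2) * |r₁ - r₂|) := by rw [mul_add]
            _ ≤ f r₂ t i + C * (2 / (r / 2) * |r₁ - r₂|) := by
                gcongr; exact hC i hi
            _ = _ := by ring
        · have : f r₁ t i = 0 := by
            simp only [hf]
            rw [klWeight_eq_zero (hs i) (by linarith [h₁.2]), mul_zero]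
          rw [this]
          exact add_nonneg (hf0 _ _ _) (by positivity)
      have hrr : r ∈ Icc (r / 2) (2 * r) := ⟨by linarith, by linarith⟩
      refine abs_iSup_sub_iSup_le (by positivity) (hfb _ _) (hfb _ _) (key r' hr' r hrr) ?_
      rw [abs_sub_comm]
      exact key r hrr r' hr'
  have hgct : ∀ r, Continuous fun t => g r t := by
    intro r
    refine continuous_iff_continuousAt.2 fun t => ?_
    obtain ⟨C, hC0, hC⟩ := hbdd' (2 * r)
    refine continuousAt_of_abs_sub_le (K := C) (Eventually.of_forall fun t' => ?_)
    have key : ∀ t₁ t₂ i, f r t₁ i ≤ f r t₂ i + C * |t₁ - t₂| := by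
      intro t₁ t₂ i
      by_cases hi : s i ≤ 2 * r
      · calc f r t₁ i ≤ e i * (klWeight (s i) (τ i) r t₂ + |t₁ - t₂|) :=
              mul_le_mul_of_nonneg_left (klWeight_le_time _ _ _ _ _) (he0 i)
          _ = f r t₂ i + e i * |t₁ - t₂| := by rw [mul_add]
          _ ≤ _ := by gcongr; exact hC i hi
      · have : f r t₁ i = 0 := by
          simp only [hf]
          rw [klWeight_eq_zero (hs i) (by linarith), mul_zero]
        rw [this]
        exact add_nonneg (hf0 _ _ _) (by positivity)
    refine abs_iSup_sub_iSup_le (by positivity) (hfb _ _) (hfb _ _) (key t' t) ?_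
    rw [abs_sub_comm]
    exact key t t'
  have hgt : ∀ r, Tendsto (fun t => g r t) atTop (𝓝 0) := by
    intro r
    rw [Metric.tendsto_atTop]
    intro ε hε
    obtain ⟨T, hT⟩ := hlim (2 * r) (ε / 2) (by positivity)
    refine ⟨T + 1, fun t ht => ?_⟩
    rw [Real.dist_eq, sub_zero, abs_of_nonneg (hg0 _ _)]
    refine lt_of_le_of_lt (hgle _ _ (ε / 2) (by positivity) fun i => ?_) (by linarith)
    rcases le_or_gt T (τ i) with h | h
    · exact hfle r t i _ (by positivity) fun hi => max_le (hT i hi h) (by positivity)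
    · simp only [hf]
      rw [klWeight_eq_zero_of_add_one_le (by linarith), mul_zero]
      positivity
  have hexp : ∀ t, 0 < Real.exp (-t) := fun t => Real.exp_pos _
  refine ⟨fun r t => g r t + r * Real.exp (-t), ⟨fun t _ => ?_, fun r hr => ?_⟩, fun i => ?_⟩
  · refine ⟨⟨(hgcr t).add (by fun_prop), by simp [hgzero], fun r hr => ?_⟩, ?_⟩
    · exact add_pos_of_nonneg_of_pos (hg0 _ _) (mul_pos hr (hexp t))
    · intro r _ r' _ h
      exact add_lt_add_of_le_of_lt (hgmono t h.le) (mul_lt_mul_of_pos_right h (hexp t))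
  · refine ⟨((hgct r).add (by fun_prop)).continuousOn, fun t _ t' _ h => ?_, ?_⟩
    · refine add_le_add (hganti r h) (mul_le_mul_of_nonneg_left ?_ hr)
      exact Real.exp_le_exp.2 (neg_le_neg h)
    · simpa using (hgt r).add (Real.tendsto_exp_neg_atTop_nhds_zero.const_mul r)
  · rcases (hs i).eq_or_lt with h0 | h0
    -- the weight vanishes at `s i = 0`, but there smallness forces `d i ≤ 0`
    · have : d i ≤ 0 := le_of_forall_gt_imp_ge_of_dense fun ε hε => by
        obtain ⟨δ, hδ, h⟩ := hsmall ε hε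
        exact h i (by linarith)
      exact this.trans (add_nonneg (hg0 _ _) (mul_nonneg (hs i) (hexp _).le))
    · have : e i ≤ g (s i) (τ i) := by
        refine le_ciSup_of_le (hfb _ _) i ?_
        simp only [hf]
        rw [klWeight_self h0, mul_one]
      exact ((le_max_left _ _).trans this).trans
        (le_add_of_nonneg_right (mul_nonneg (hs i) (hexp _).le))

/-- A family of data `d i` at the points `s i ≥ 0` that is bounded for bounded `s` and small for
small `s` is dominated by a function of class `𝒦`. -/
theorem exists_classK_majorant {ι : Type*} (s d : ι → ℝ) (hs : ∀ i, 0 ≤ s i)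
    (hbdd : ∀ R, ∃ C, ∀ i, s i ≤ R → d i ≤ C)
    (hsmall : ∀ ε, 0 < ε → ∃ δ, 0 < δ ∧ ∀ i, s i ≤ δ → d i ≤ ε) :
    ∃ ω : ℝ → ℝ, ClassK ω ∧ ∀ i, d i ≤ ω (s i) := by
  obtain ⟨β, hβ, h⟩ := exists_classKL_majorant s (fun _ => 0) d hs hbdd hsmall
    fun R ε _ => ⟨1, fun i _ h => absurd h (by norm_num)⟩
  exact ⟨fun r => β r 0, hβ.classK 0 le_rfl, h⟩

lemma ClassK.classN {a : ℝ → ℝ} (ha : ClassK a) : ClassN a :=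
  ⟨ha.continuousOn, ha.strictMonoOn.monotoneOn, ha.map_zero⟩

lemma ClassN.nonneg {a : ℝ → ℝ} (ha : ClassN a) {s : ℝ} (hs : 0 ≤ s) : 0 ≤ a s :=
  ha.map_zero ▸ ha.monotoneOn self_mem_Ici hs hs

/-- A function of class `𝒩` is small near zero. -/
lemma ClassN.exists_le {a : ℝ → ℝ} (ha : ClassN a) {ε : ℝ} (hε : 0 < ε) :
    ∃ δ, 0 < δ ∧ a δ ≤ ε := by
  have h := (ha.continuousOn 0 self_mem_Ici).mono Ioi_subset_Ici_self
  rw [ContinuousWithinAt, ha.map_zero] at h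
  obtain ⟨δ, h1, h2⟩ := ((h.eventually (ge_mem_nhds hε)).and self_mem_nhdsWithin).exists
  exact ⟨δ, h2, h1⟩

lemma ClassN.comp {a b : ℝ → ℝ} (ha : ClassN a) (hb : ClassN b) : ClassN (fun s => a (b s)) :=
  ⟨ha.continuousOn.comp hb.continuousOn fun _ h => hb.nonneg h,
    fun _ hs _ ht h => ha.monotoneOn (hb.nonneg hs) (hb.nonneg ht) (hb.monotoneOn hs ht h),
    by simp [hb.map_zero, ha.map_zero]⟩

lemma ClassN.add {a b : ℝ → ℝ} (ha : ClassN a) (hb : ClassN b) : ClassN (fun s => a s + b s) :=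
  ⟨ha.continuousOn.add hb.continuousOn, ha.monotoneOn.add hb.monotoneOn,
    by simp [hb.map_zero, ha.map_zero]⟩

lemma classN_const_mul {c : ℝ} (hc : 0 ≤ c) : ClassN (fun s => c * s) :=
  ⟨by fun_prop, fun _ _ _ _ h => mul_le_mul_of_nonneg_left h hc, by simp⟩

/-- The weak triangle inequality for functions of class `𝒩`. -/
lemma ClassN.le_add_of_le {a : ℝ → ℝ} (ha : ClassN a) {s p q : ℝ} (hs : 0 ≤ s) (hp : 0 ≤ p)
    (hq : 0 ≤ q) (h : s ≤ p + q) : a s ≤ a (2 * p) + a (2 * q) := by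
  have h1 := ha.nonneg (show 0 ≤ 2 * p by linarith)
  have h2 := ha.nonneg (show 0 ≤ 2 * q by linarith)
  rcases le_total p q with hpq | hpq
  · have := ha.monotoneOn hs (show 0 ≤ 2 * q by linarith) (by linarith)
    linarith
  · have := ha.monotoneOn hs (show 0 ≤ 2 * p by linarith) (by linarith)
    linarith

/-! ### Scalar Razumikhin inequalities -/

/-- The scalar data extracted from a solution on `[-Δ, T]`: `v` is the Lyapunov function along the
solution, and `E t` is the energy supplied by the input up to time `t`. Where the Razumikhin
condition holds, `v` decreases, up to the supplied energy, at rate at least `c p q` as long as it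
stays between the levels `p` and `q`. -/
structure RazumikhinDecay (Δ T : ℝ) (ρ : ℝ → ℝ) (c : ℝ → ℝ → ℝ) (v E : ℝ → ℝ) : Prop where
  continuousOn : ContinuousOn v (Icc (-Δ) T)
  nonneg : ∀ t ∈ Icc (-Δ) T, 0 ≤ v t
  energy_continuousOn : ContinuousOn E (Icc 0 T)
  energy_monotoneOn : MonotoneOn E (Icc 0 T)
  energy_zero : E 0 = 0
  decay : ∀ p q a b, 0 < p → 0 ≤ a → a ≤ b → b ≤ T → (∀ t ∈ Icc a b, p ≤ v t ∧ v t ≤ q) →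
    (∀ t ∈ Icc a b, ∀ s ∈ Icc (t - Δ) t, ρ (v s) ≤ v t) →
    v b - v a ≤ E b - E a - c p q * (b - a)

section

variable {Δ T : ℝ} {ρ : ℝ → ℝ} {c : ℝ → ℝ → ℝ} {v E : ℝ → ℝ}

/-- The initial bound is exceeded by at most the supplied energy. At a maximum point of `v - E`
where this failed, the Razumikhin condition would hold, and `v - E` would strictly decrease just
before that point. -/
theorem RazumikhinDecay.le_add_energy (h : RazumikhinDecay Δ T ρ c v E) (hΔ : 0 ≤ Δ)
    (hc : ∀ p q, 0 < p → p ≤ q → 0 < c p q) (hρ : ClassKInf ρ) (hρlt : ∀ s, 0 < s → ρ s < s)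
    {M : ℝ} (hM : ∀ s ∈ Icc (-Δ) 0, v s ≤ M) {t : ℝ} (ht : t ∈ Icc 0 T) : v t ≤ M + E t := by
  have hT : 0 ≤ T := ht.1.trans ht.2
  have hsub : Icc 0 T ⊆ Icc (-Δ) T := Icc_subset_Icc_left (by linarith)
  obtain ⟨t₂, ht₂, hmax⟩ := isCompact_Icc.exists_isMaxOn (nonempty_Icc.2 hT)
    ((h.continuousOn.mono hsub).sub h.energy_continuousOn)
  have hmax' : ∀ s ∈ Icc 0 T, v s - E s ≤ v t₂ - E t₂ := hmax
  by_contra! hcon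
  have hM0 : 0 ≤ M :=
    (h.nonneg 0 ⟨by linarith, hT⟩).trans (hM 0 ⟨by linarith, le_rfl⟩)
  have hH : M < v t₂ - E t₂ := by linarith [hmax' t ht]
  have hEnn : 0 ≤ E t₂ := by
    have := h.energy_monotoneOn ⟨le_rfl, hT⟩ ht₂ ht₂.1
    rwa [h.energy_zero] at this
  have ht₂0 : 0 < t₂ := by
    rcases ht₂.1.eq_or_lt with h0 | h0
    · rw [← h0, h.energy_zero] at hH
      linarith [hM 0 ⟨by linarith, le_rfl⟩]
    · exact h0
  have hv2 : 0 < v t₂ := by linarith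
  have hhist : ∀ s ∈ Icc (-Δ) t₂, v s ≤ v t₂ := by
    intro s hs
    rcases le_total s 0 with hs0 | hs0
    · linarith [hM s ⟨hs.1, hs0⟩]
    · have hsT : s ∈ Icc 0 T := ⟨hs0, hs.2.trans ht₂.2⟩
      linarith [hmax' s hsT, h.energy_monotoneOn hsT ht₂ hs.2]
  have hev : ∀ᶠ s in 𝓝[Icc 0 T] t₂, max (ρ (v t₂)) (v t₂ / 2) < v s :=
    ((h.continuousOn.mono hsub) t₂ ht₂).eventually
      (lt_mem_nhds (max_lt (hρlt _ hv2) (half_lt_self hv2)))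
  obtain ⟨δ, hδ, hball⟩ := Metric.mem_nhdsWithin_iff.1 hev
  set a := max 0 (t₂ - δ / 2) with ha
  have ha0 : 0 ≤ a := le_max_left _ _
  have hat : a < t₂ := max_lt ht₂0 (by linarith)
  have hnear : ∀ s ∈ Icc a t₂, max (ρ (v t₂)) (v t₂ / 2) < v s := by
    intro s hs
    have h1 : t₂ - δ / 2 ≤ s := (le_max_right _ _).trans hs.1
    refine hball ⟨?_, ha0.trans hs.1, hs.2.trans ht₂.2⟩
    rw [Metric.mem_ball, Real.dist_eq, abs_lt]
    constructor <;> linarith [hs.2]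
  have hdec := h.decay (v t₂ / 2) (v t₂) a t₂ (half_pos hv2) ha0 hat.le ht₂.2
    (fun s hs => ⟨((le_max_right _ _).trans_lt (hnear s hs)).le,
      hhist s ⟨by linarith [hs.1], hs.2⟩⟩)
    (fun s hs r hr => by
      have hr' : r ∈ Icc (-Δ) t₂ := ⟨by linarith [hr.1, hs.1], hr.2.trans hs.2⟩
      refine le_trans ?_ ((le_max_left _ _).trans_lt (hnear s hs)).le
      exact hρ.strictMonoOn.monotoneOn (h.nonneg r ⟨hr'.1, hr'.2.trans ht₂.2⟩) hv2.le
        (hhist r hr'))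
  have := mul_pos (hc _ _ (half_pos hv2) (half_le_self hv2.le)) (sub_pos.2 hat)
  linarith [hmax' a ⟨ha0, hat.le.trans ht₂.2⟩]

/-- If `v ≤ N` from some time on, then `v` falls below `ρ N` within a controlled time, and later
exceeds this level by at most the supplied energy. -/
theorem RazumikhinDecay.le_apply_add_energy (h : RazumikhinDecay Δ T ρ c v E)
    (hρ : ClassKInf ρ) {N p q t₀ : ℝ} (ht₀ : 0 ≤ t₀)
    (hN : ∀ s ∈ Icc (t₀ - Δ) T, v s ≤ N) (hN0 : 0 < N) (hET : 0 ≤ E T) (hp : 0 < p) (hpN : p ≤ ρ N)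
    (hNq : N ≤ q) (hc : 0 < c p q) (hΔ : 0 ≤ Δ) {t : ℝ}
    (ht : t₀ + (q + E T + 1) / c p q ≤ t) (htT : t ≤ T) : v t ≤ ρ N + E T := by
  have hE : ∀ a b, 0 ≤ a → a ≤ b → b ≤ T → E b - E a ≤ E T := by
    intro a b ha hab hb
    have h1 := h.energy_monotoneOn ⟨le_rfl, by linarith⟩ ⟨ha, by linarith⟩ ha
    have h2 := h.energy_monotoneOn ⟨by linarith, hb⟩ ⟨by linarith, le_rfl⟩ hb
    rw [h.energy_zero] at h1
    linarith
  have hq : 0 < (q + E T + 1) / c p q := by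
    have := hN0.trans_le hNq
    positivity
  have ht0t : t₀ ≤ t := by linarith
  -- above the level `ρ N` the Razumikhin condition holds automatically
  have hdec : ∀ a b, t₀ ≤ a → a ≤ b → b ≤ T → (∀ s ∈ Icc a b, ρ N ≤ v s) →
      v b - v a ≤ E b - E a - c p q * (b - a) := by
    intro a b ha hab hb hs
    refine h.decay p q a b hp (ht₀.trans ha) hab hb (fun s hs' => ⟨hpN.trans (hs s hs'), ?_⟩) ?_
    · exact (hN s ⟨by linarith [hs'.1], hs'.2.trans hb⟩).trans hNq
    · intro s hs' r hr
      refine le_trans ?_ (hs s hs')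
      have hr1 : r ∈ Icc (t₀ - Δ) T := ⟨by linarith [hr.1, hs'.1], by linarith [hr.2, hs'.2]⟩
      exact hρ.strictMonoOn.monotoneOn
        (h.nonneg r ⟨by linarith [hr1.1], hr1.2⟩) hN0.le (hN r hr1)
  have hcont : ContinuousOn v (Icc t₀ t) :=
    h.continuousOn.mono (Icc_subset_Icc (by linarith) htT)
  -- `v` must reach the level `ρ N` before time `t`
  obtain ⟨t₁, ht₁, hlow⟩ : ∃ t₁ ∈ Icc t₀ t, v t₁ ≤ ρ N := by
    by_contra! hcon
    have h1 := hdec t₀ t le_rfl ht0t htT fun s hs => (hcon s hs).le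
    have h2 := hE t₀ t ht₀ ht0t htT
    have h3 : q + E T + 1 ≤ c p q * (t - t₀) := by
      rw [mul_comm, ← div_le_iff₀ hc]
      linarith
    have h4 := h.nonneg t ⟨by linarith, htT⟩
    have h5 := hN t₀ ⟨by linarith, by linarith⟩
    linarith
  -- the last time before `t` at which `v` is at most `ρ N`
  have hclosed : IsCompact (Icc t₀ t ∩ v ⁻¹' Iic (ρ N)) :=
    isCompact_Icc.of_isClosed_subset (hcont.preimage_isClosed_of_isClosed isClosed_Icc isClosed_Iic)
      inter_subset_left
  obtain ⟨t₂, ⟨ht₂, hv₂⟩, hlast⟩ := hclosed.exists_isGreatest ⟨t₁, ht₁, hlow⟩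
  have habove : ∀ s ∈ Ioc t₂ t, ρ N < v s := by
    intro s hs
    by_contra! hcon
    exact absurd (hlast ⟨⟨ht₂.1.trans hs.1.le, hs.2⟩, hcon⟩) (not_le.2 hs.1)
  rcases ht₂.2.eq_or_lt with heq | hlt
  · rw [← heq]
    exact le_add_of_le_of_nonneg hv₂ hET
  have hv₂' : v t₂ = ρ N := by
    refine le_antisymm hv₂ ?_
    have h1 : ContinuousWithinAt v (Ioc t₂ t) t₂ :=
      (hcont t₂ ht₂).mono fun s hs => ⟨ht₂.1.trans hs.1.le, hs.2⟩
    have h2 : t₂ ∈ closure (Ioc t₂ t) := by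
      rw [closure_Ioc hlt.ne]
      exact ⟨le_rfl, hlt.le⟩
    have := mem_closure_iff_nhdsWithin_neBot.1 h2
    exact ge_of_tendsto h1
      (eventually_mem_nhdsWithin.mono fun s hs => (habove s hs).le)
  have h1 := hdec t₂ t ht₂.1 ht₂.2 htT fun s hs => by
    rcases hs.1.eq_or_lt with h0 | h0
    · rw [← h0, hv₂']
    · exact (habove s ⟨h0, hs.2⟩).le
  have h2 := hE t₂ t (ht₀.trans ht₂.1) ht₂.2 htT
  have h3 := mul_nonneg hc.le (sub_nonneg.2 ht₂.2)
  linarith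

end

/-- The gain margin turns into a level: there is `σ` of class `𝒩` such that above the level `σ G`
an energy `G` is at most half of the gap left by one application of the gain. -/
lemma exists_classN_level {ρ κ : ℝ → ℝ} (hρ : ClassKInf ρ) (hκ : ClassKInf κ) :
    ∃ σ : ℝ → ℝ, ClassN σ ∧ ∀ G N, 0 ≤ G → 0 ≤ N → σ G < N → 2 * G < κ (ρ N) := by
  have hmono : MonotoneOn (fun s => κ (ρ s)) (Ici 0) :=
    (hκ.toClassK.classN.comp hρ.toClassK.classN).monotoneOn
  have hpos : ∀ s, 0 < s → 0 < κ (ρ s) := fun s hs => hκ.pos _ (hρ.pos _ hs)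
  suffices H : ∃ σ : ℝ → ℝ, ClassK σ ∧
      ∀ i : {x : ℝ × ℝ // 0 ≤ x.1 ∧ 0 ≤ x.2 ∧ κ (ρ x.2) ≤ 2 * x.1}, i.1.2 ≤ σ i.1.1 by
    obtain ⟨σ, hσ, h⟩ := H
    refine ⟨σ, hσ.classN, fun G N hG hN hlt => ?_⟩
    by_contra! hcon
    exact absurd (h ⟨(G, N), hG, hN, hcon⟩) (not_le.2 hlt)
  refine exists_classK_majorant _ _ (fun i => i.2.1) ?_ ?_
  · intro R
    obtain ⟨C, hC0, hC⟩ := ((eventually_ge_atTop 0).and ((hκ.tendsto_atTop.comp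
      hρ.tendsto_atTop).eventually (eventually_gt_atTop (2 * R)))).exists
    refine ⟨C, fun ⟨⟨G, N⟩, hG, hN, hGN⟩ hR => ?_⟩
    by_contra! hcon
    have := hmono hC0 hN hcon.le
    simp only [Function.comp_apply] at hC hR hGN this
    linarith
  · intro ε hε
    refine ⟨κ (ρ ε) / 4, by linarith [hpos ε hε], fun ⟨⟨G, N⟩, hG, hN, hGN⟩ hR => ?_⟩
    by_contra! hcon
    have := hmono hε.le hN hcon.le
    simp only at hR hGN this
    linarith [hpos ε hε]

/-- After a time that depends only on the size of the initial segment and on the accuracy `ε`, the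
function `v` is bounded by `ε` plus a function of the supplied energy: above this level each step
of a fixed length decreases the bound on `v` by at least a fixed amount. -/
theorem exists_time_le_of_razumikhinDecay {Δ : ℝ} {ρ κ σ : ℝ → ℝ} {c : ℝ → ℝ → ℝ} (hΔ : 0 ≤ Δ)
    (hc : ∀ p q, 0 < p → p ≤ q → 0 < c p q) (hρ : ClassKInf ρ) (hκ : ClassKInf κ)
    (hgain : ∀ s, 0 ≤ s → ρ s + κ (ρ s) ≤ s) (hσ : ClassN σ)
    (hlevel : ∀ G N, 0 ≤ G → 0 ≤ N → σ G < N → 2 * G < κ (ρ N)) (R ε : ℝ) (hε : 0 < ε) :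
    ∃ Θ : ℝ, ∀ (T M : ℝ) (v E : ℝ → ℝ), RazumikhinDecay Δ T ρ c v E → 0 ≤ T → Θ ≤ T → M ≤ R →
      (∀ s ∈ Icc (-Δ) 0, v s ≤ M) → v T ≤ ε + (σ (E T) + 2 * E T) := by
  have hρlt : ∀ s, 0 < s → ρ s < s := fun s hs => by
    linarith [hgain s hs.le, hκ.pos _ (hρ.pos s hs)]
  set q := 2 * R + σ R + ε with hq
  set p := ρ ε with hp
  have hp0 : 0 < p := hρ.pos ε hε
  set d := κ (ρ ε) / 2 with hd
  have hd0 : 0 < d := by linarith [hκ.pos _ hp0]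
  set step := (q + R + 1) / c p q + Δ with hstep
  obtain ⟨k, hk⟩ := exists_nat_ge (2 * R / d)
  refine ⟨k * step, fun T M v E h hT hΘ hMR hM => ?_⟩
  have hE0 : 0 ≤ E T := by
    have := h.energy_monotoneOn ⟨le_rfl, hT⟩ ⟨hT, le_rfl⟩ hT
    rwa [h.energy_zero] at this
  have hσ0 := hσ.nonneg hE0
  have hbase := h.le_add_energy hΔ hc hρ hρlt hM ⟨hT, le_rfl⟩
  have hM0 : 0 ≤ M := (h.nonneg 0 ⟨by linarith, hT⟩).trans (hM 0 ⟨by linarith, le_rfl⟩)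
  -- if the energy exceeds the initial bound, the crude estimate suffices
  rcases le_total R (E T) with hRE | hRE
  · linarith
  have hR0 : 0 ≤ R := hM0.trans hMR
  have hσR := hσ.monotoneOn hE0 hR0 hRE
  have hσR0 := hσ.nonneg hR0
  have hpq : p ≤ q := by linarith [hρlt ε hε]
  have hcpq := hc p q hp0 hpq
  have hstep0 : 0 ≤ step := by
    have : 0 ≤ (q + R + 1) / c p q := by
      have : 0 ≤ q := by linarith
      positivity
    linarith
  set B := σ (E T) + ε with hB
  have key : ∀ j : ℕ, ∀ t ∈ Icc (j * step - Δ) T, v t ≤ max B (2 * R - j * d) := by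
    intro j
    induction j with
    | zero =>
      intro t ht
      simp only [Nat.cast_zero, zero_mul, zero_sub, sub_zero] at ht ⊢
      refine le_max_of_le_right ?_
      rcases le_total t 0 with ht0 | ht0
      · linarith [hM t ⟨ht.1, ht0⟩]
      · have h1 := h.le_add_energy hΔ hc hρ hρlt hM ⟨ht0, ht.2⟩
        have h2 := h.energy_monotoneOn ⟨ht0, ht.2⟩ ⟨hT, le_rfl⟩ ht.2
        linarith
    | succ j ih =>
      intro t ht
      set N := max B (2 * R - j * d) with hN
      have hBN : B ≤ N := le_max_left _ _
      have hεN : ε ≤ N := by linarith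
      have hNpos : 0 < N := hε.trans_le hεN
      have hNq : N ≤ q := max_le (by linarith) (by nlinarith [Nat.cast_nonneg (α := ℝ) j])
      have hpN : p ≤ ρ N := hρ.strictMonoOn.monotoneOn hε.le hNpos.le hεN
      have hle : (j : ℝ) * step + (q + E T + 1) / c p q ≤ t := by
        have h1 : (q + E T + 1) / c p q ≤ (q + R + 1) / c p q := by gcongr
        have h2 := ht.1
        push_cast at h2
        linarith
      have h1 := h.le_apply_add_energy hρ (t₀ := j * step) (by positivity) ih hNpos hE0 hp0 hpN hNq
        hcpq hΔ hle ht.2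
      -- one application of the gain wins `κ (ρ N) - E T`, which is at least `d`
      have h2 := hlevel (E T) N hE0 hNpos.le (by linarith)
      have h3 := hgain N hNpos.le
      have h4 : κ (ρ ε) ≤ κ (ρ N) :=
        hκ.strictMonoOn.monotoneOn hp0.le (hp0.le.trans hpN) hpN
      have h5 : v t ≤ N - d := by linarith
      refine h5.trans ?_
      rw [sub_le_iff_le_add]
      refine max_le ?_ ?_
      · linarith [le_max_left B (2 * R - (j + 1 : ℕ) * d)]
      · have := le_max_right B (2 * R - (j + 1 : ℕ) * d)
        push_cast at this ⊢
        linarith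
  have h1 := key k T ⟨by linarith, le_rfl⟩
  have h2 : 2 * R - k * d ≤ B := by
    rw [div_le_iff₀ hd0] at hk
    linarith
  rw [max_eq_left h2] at h1
  linarith

/-! ### Lyapunov functions along solutions -/

/-- Integrated chain rule: if `y` is a primitive of a bounded `g` and the derivative of `V` along
`y` is almost everywhere at most `h`, then `V ∘ y` increases by at most the integral of `h`. -/
theorem sub_le_integral_of_inner_gradient_le {n : ℕ} {V : Vec n → ℝ} (hV : ContDiff ℝ 1 V)
    {y g : ℝ → Vec n} {h : ℝ → ℝ} {a b K : ℝ} (hab : a ≤ b)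
    (hg : IntervalIntegrable g volume a b) (hgK : ∀ᵐ t, t ∈ Ioc a b → ‖g t‖ ≤ K)
    (hy : ∀ t ∈ Icc a b, y t = y a + ∫ s in a..t, g s)
    (hh : IntervalIntegrable h volume a b)
    (hle : ∀ᵐ t, t ∈ Icc a b → inner ℝ (gradient V (y t)) (g t) ≤ h t) :
    V (y b) - V (y a) ≤ ∫ t in a..b, h t := by
  set Y : ℝ → Vec n := fun t => y a + ∫ s in a..t, g s with hY
  have hgi : ∀ t ∈ Icc a b, IntervalIntegrable g volume a t := fun t ht =>
    hg.mono_set (by rw [uIcc_of_le ht.1, uIcc_of_le hab]; exact Icc_subset_Icc_right ht.2)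
  have hYlip : LipschitzOnWith (Real.toNNReal K) Y (Icc a b) := by
    refine LipschitzOnWith.of_dist_le_mul fun s hs t ht => ?_
    have h1 : Y s - Y t = ∫ r in t..s, g r := by
      simp only [hY, add_sub_add_left_eq_sub]
      exact intervalIntegral.integral_interval_sub_left (hgi s hs) (hgi t ht)
    rw [dist_eq_norm, h1, Real.dist_eq]
    refine intervalIntegral.norm_integral_le_of_norm_le_const_ae ?_
    filter_upwards [hgK] with r hr hrm
    refine (hr ⟨?_, ?_⟩).trans (Real.le_coe_toNNReal K)
    · exact (le_min ht.1 hs.1).trans_lt hrm.1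
    · exact hrm.2.trans (max_le ht.2 hs.2)
  have hcomp : IsCompact (Y '' Icc a b) := isCompact_Icc.image_of_continuousOn hYlip.continuousOn
  obtain ⟨r, hr⟩ := hcomp.isBounded.subset_closedBall 0
  obtain ⟨C, hC⟩ := (hV.contDiffOn (s := Metric.closedBall 0 r)).exists_lipschitzOnWith
    (by decide) (convex_closedBall _ _) (isCompact_closedBall _ _)
  have hlip : LipschitzOnWith (C * Real.toNNReal K) (V ∘ Y) (Icc a b) :=
    hC.comp hYlip fun t ht => hr (mem_image_of_mem _ ht)
  rw [← uIcc_of_le hab] at hlip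
  have hac := hlip.absolutelyContinuousOnInterval
  have hYa : Y a = y a := by simp [hY]
  have hYy : ∀ t ∈ Icc a b, Y t = y t := fun t ht => (hy t ht).symm
  have heq : V (y b) - V (y a) = ∫ t in a..b, deriv (V ∘ Y) t := by
    rw [hac.integral_deriv_eq_sub, Function.comp_apply, Function.comp_apply, hYa,
      hYy b ⟨hab, le_rfl⟩]
  rw [heq]
  refine intervalIntegral.integral_mono_ae_restrict hab hac.intervalIntegrable_deriv hh ?_
  refine (ae_restrict_iff' measurableSet_Icc).2 ?_
  filter_upwards [hle, hg.ae_hasDerivAt_integral] with t h1 h2 ht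
  have h3 : HasDerivAt Y (g t) t :=
    (h2 (by rwa [uIcc_of_le hab]) a left_mem_uIcc).const_add _
  have h4 := (hV.differentiable one_ne_zero (Y t)).hasGradientAt.hasFDerivAt.comp_hasDerivAt t h3
  rw [h4.deriv, InnerProductSpace.toDual_apply_apply, hYy t ht]
  exact h1 ht

lemma histSegment_apply {n : ℕ} {Δ : ℝ≥0} {x : ℝ → Vec n} {t : ℝ}
    (hx : ContinuousOn x (Icc (t - Δ) t)) (τ : Icc (-(Δ : ℝ)) 0) :
    histSegment Δ x t τ = x (t + τ) := by
  have hc : Continuous fun τ : Icc (-(Δ : ℝ)) 0 => x (t + τ) :=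
    hx.comp_continuous (by fun_prop)
      fun τ => ⟨by linarith [τ.2.1], by linarith [τ.2.2]⟩
  exact ContinuousMap.mkD_apply_of_continuous hc

lemma histSegment_now {n : ℕ} {Δ : ℝ≥0} {x : ℝ → Vec n} {t : ℝ}
    (hx : ContinuousOn x (Icc (t - Δ) t)) : (histSegment Δ x t).now = x t := by
  rw [Hist.now, histSegment_apply hx, add_zero]

lemma norm_histSegment_le {n : ℕ} {Δ : ℝ≥0} {x : ℝ → Vec n} {t K : ℝ}
    (hx : ContinuousOn x (Icc (t - Δ) t)) (hK0 : 0 ≤ K) (hK : ∀ s ∈ Icc (t - Δ) t, ‖x s‖ ≤ K) :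
    ‖histSegment Δ x t‖ ≤ K := by
  refine (ContinuousMap.norm_le _ hK0).2 fun τ => ?_
  rw [histSegment_apply hx]
  exact hK _ ⟨by linarith [τ.2.1], by linarith [τ.2.2]⟩

lemma norm_now_le {n : ℕ} {Δ : ℝ≥0} (φ : Hist Δ n) : ‖φ.now‖ ≤ ‖φ‖ := φ.norm_coe_le_norm _

section

variable {Δ : ℝ≥0} {n m : ℕ}

lemma LipschitzOnBoundedSets.exists_bound {F : Vec n → Hist Δ n → Vec m → Vec n}
    (hF : LipschitzOnBoundedSets F) (hF0 : F 0 0 0 = 0) {r : ℝ} (hr : 0 < r) :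
    ∃ K, 0 ≤ K ∧ ∀ x φ v, ‖x‖ ≤ r → ‖φ‖ ≤ r → ‖v‖ ≤ r → ‖F x φ v‖ ≤ K := by
  obtain ⟨L, hL, h⟩ := hF r hr
  refine ⟨L * (r + r + r), by positivity, fun x φ v hx hφ hv => ?_⟩
  have := h x 0 φ 0 v 0 hx (by simpa using hr.le) hφ (by simpa using hr.le) hv
    (by simpa using hr.le)
  rw [hF0, sub_zero, sub_zero, sub_zero, sub_zero] at this
  exact this.trans (by gcongr)

lemma IsInput.exists_bound {u : ℝ → Vec m} (hu : IsInput u) (T : ℝ) :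
    ∃ C, 0 < C ∧ ∀ᵐ t, t ∈ Icc 0 T → ‖u t‖ ≤ C := by
  obtain ⟨C, hC⟩ := hu.locallyEssBounded T
  refine ⟨max C 1, by positivity, ?_⟩
  filter_upwards [(ae_restrict_iff' measurableSet_Icc).1 hC] with t h ht
  exact (h ht).trans (le_max_left _ _)

lemma IsInput.intervalIntegrable {u : ℝ → Vec m} (hu : IsInput u) {γ : ℝ → ℝ} (hγ : ClassN γ)
    {a b : ℝ} (ha : 0 ≤ a) (hb : 0 ≤ b) :
    IntervalIntegrable (fun t => γ ‖u t‖) volume a b := by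
  obtain ⟨C, hC0, hC⟩ := hu.exists_bound (max a b)
  have hcont : Continuous fun s : ℝ => γ (max 0 s) :=
    hγ.continuousOn.comp_continuous (by fun_prop) fun s => mem_Ici.2 (le_max_left _ _)
  have hsub : uIoc a b ⊆ Ici 0 := fun t ht => (le_min ha hb).trans ht.1.le
  have hmeas : AEStronglyMeasurable (fun t => γ ‖u t‖) (volume.restrict (uIoc a b)) := by
    have := hcont.comp_aestronglyMeasurable
      (hu.aestronglyMeasurable.mono_measure (Measure.restrict_mono hsub le_rfl)).norm
    simpa using this
  rw [intervalIntegrable_iff]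
  refine IntegrableOn.of_bound (by simp [uIoc]) hmeas (γ C) ?_
  refine (ae_restrict_iff' measurableSet_uIoc).2 ?_
  filter_upwards [hC] with t h ht
  rw [Real.norm_of_nonneg (hγ.nonneg (norm_nonneg _))]
  exact hγ.monotoneOn (norm_nonneg (u t)) hC0.le (h ⟨hsub ht, ht.2⟩)

lemma exists_norm_le_of_le_level {V : Vec n → ℝ}
    (hVunb : Tendsto V (Bornology.cobounded (Vec n)) atTop) (R : ℝ) :
    ∃ C, ∀ x, V x ≤ R → ‖x‖ ≤ C := by
  have hbdd : Bornology.IsBounded {x | V x ≤ R} :=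
    Bornology.isBounded_def.2 (mem_of_superset (hVunb.eventually (eventually_gt_atTop R))
      fun x (hx : R < V x) => not_le.2 hx)
  exact hbdd.exists_norm_le

/-- On the region between two positive levels of `V` the dissipation rate is bounded below. -/
lemma exists_pos_le_of_mem_levels {V : Vec n → ℝ} (hV : Continuous V) (hV0 : V 0 = 0)
    (hVunb : Tendsto V (Bornology.cobounded (Vec n)) atTop) {α : ℝ → ℝ} (hα : ClassP α)
    {p : ℝ} (hp : 0 < p) (q : ℝ) :
    ∃ c, 0 < c ∧ ∀ x, p ≤ V x → V x ≤ q → c ≤ α ‖x‖ := by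
  set S := V ⁻¹' Icc p q with hS
  have hclosed : IsClosed S := isClosed_Icc.preimage hV
  obtain ⟨C, hC⟩ := exists_norm_le_of_le_level hVunb q
  have hbdd : Bornology.IsBounded S :=
    isBounded_iff_forall_norm_le.2 ⟨C, fun x hx => hC x hx.2⟩
  have hcompact : IsCompact S := Metric.isCompact_of_isClosed_isBounded hclosed hbdd
  rcases S.eq_empty_or_nonempty with hempty | hne
  · refine ⟨1, one_pos, fun x h1 h2 => ?_⟩
    have : x ∈ S := ⟨h1, h2⟩
    rw [hempty] at this
    exact absurd this (notMem_empty x)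
  · have hcont : ContinuousOn (fun x : Vec n => α ‖x‖) S :=
      hα.continuousOn.comp continuous_norm.continuousOn fun x _ => norm_nonneg x
    obtain ⟨x₀, hx₀, hmin⟩ := hcompact.exists_isMinOn hne hcont
    refine ⟨α ‖x₀‖, hα.pos _ (norm_pos_iff.2 ?_), fun x h1 h2 => hmin ⟨h1, h2⟩⟩
    rintro rfl
    have := hx₀.1
    rw [hV0] at this
    linarith

variable {f : Hist Δ n → Vec m → Vec n} {x₀ : Hist Δ n} {u : ℝ → Vec m} {T : EReal}
  {x : ℝ → Vec n}

lemma IsSolution.continuousOn_Icc (h : IsSolution f x₀ u T x) {t : ℝ} (ht : (t : EReal) < T) :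
    ContinuousOn x (Icc (-(Δ : ℝ)) t) :=
  h.continuousOn.mono fun _ hs => ⟨hs.1, (EReal.coe_le_coe_iff.2 hs.2).trans_lt ht⟩

/-- The Razumikhin condition makes the Lyapunov function decrease along solutions, up to the energy
`∫ γ |u|` supplied by the input, at a rate that does not depend on the solution. -/
theorem IsSolution.razumikhinDecay {F : Vec n → Hist Δ n → Vec m → Vec n}
    (hF : LipschitzOnBoundedSets F) (hF0 : F 0 0 0 = 0)
    {V : Vec n → ℝ} (hV : ContDiff ℝ 1 V) (hVnn : ∀ x, 0 ≤ V x)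
    {α γ ρ : ℝ → ℝ} (hγ : ClassN γ) (hρ : ClassKInf ρ) {c : ℝ → ℝ → ℝ}
    (hc : ∀ p q, 0 < p → ∀ x, p ≤ V x → V x ≤ q → c p q ≤ α ‖x‖)
    (hdiss : ∀ (φ w : Hist Δ n) (v : Vec m),
      ρ (⨆ τ : Icc (-(Δ : ℝ)) 0, V (w τ)) ≤ V φ.now →
        inner ℝ (gradient V φ.now) (F φ.now w v) ≤ -α ‖φ.now‖ + γ ‖v‖)
    (hu : IsInput u) (hx : IsSolution (closedLoop F) x₀ u T x) {T' : ℝ} (hT'0 : 0 ≤ T')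
    (hT' : (T' : EReal) < T) :
    RazumikhinDecay Δ T' ρ c (fun t => V (x t)) (fun t => ∫ τ in (0 : ℝ)..t, γ ‖u τ‖) := by
  have hxc := hx.continuousOn_Icc hT'
  have hγi : ∀ {a b}, 0 ≤ a → 0 ≤ b → IntervalIntegrable (fun t => γ ‖u t‖) volume a b :=
    fun ha hb => hu.intervalIntegrable hγ ha hb
  refine ⟨hV.continuous.comp_continuousOn hxc, fun t _ => hVnn _, ?_, ?_, by simp, ?_⟩
  · have := intervalIntegral.continuousOn_primitive_interval' (hγi le_rfl hT'0) left_mem_uIcc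
    rwa [uIcc_of_le hT'0] at this
  · intro s hs t ht hst
    rw [← sub_nonneg, intervalIntegral.integral_interval_sub_left (hγi le_rfl ht.1)
      (hγi le_rfl hs.1)]
    exact intervalIntegral.integral_nonneg hst fun r _ => hγ.nonneg (norm_nonneg _)
  · intro p q a b hp ha hab hb hpq hraz
    have hxi : ∀ t ∈ Icc 0 T', IntervalIntegrable
        (fun τ => closedLoop F (histSegment Δ x τ) (u τ)) volume 0 t :=
      fun t ht => hx.integrable t ht.1 ((EReal.coe_le_coe_iff.2 ht.2).trans_lt hT')
    have haT : a ∈ Icc 0 T' := ⟨ha, hab.trans hb⟩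
    have hbT : b ∈ Icc 0 T' := ⟨ha.trans hab, hb⟩
    have hwin : ∀ t ∈ Icc 0 T', ContinuousOn x (Icc (t - Δ) t) := fun t ht =>
      hxc.mono (Icc_subset_Icc (by linarith [ht.1]) ht.2)
    obtain ⟨R, hR⟩ := (isCompact_Icc.image_of_continuousOn hxc).isBounded.exists_norm_le
    obtain ⟨C, hC0, hC⟩ := hu.exists_bound T'
    set r := max (max R 1) C with hr
    have hr0 : 0 < r := hC0.trans_le (le_max_right _ _)
    obtain ⟨K, -, hK⟩ := hF.exists_bound hF0 hr0
    have hh : IntervalIntegrable (fun t => γ ‖u t‖ - c p q) volume a b :=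
      (hγi ha hbT.1).sub intervalIntegrable_const
    have key := sub_le_integral_of_inner_gradient_le hV (y := x) (K := K)
      (g := fun τ => closedLoop F (histSegment Δ x τ) (u τ)) hab
      ((hxi a haT).symm.trans (hxi b hbT)) ?_ ?_ hh ?_
    · rw [intervalIntegral.integral_sub (hγi ha hbT.1) intervalIntegrable_const,
        intervalIntegral.integral_const, smul_eq_mul,
        ← intervalIntegral.integral_interval_sub_left (hγi le_rfl hbT.1) (hγi le_rfl ha)] at key
      linarith
    · filter_upwards [hC] with t hut ht
      have htT : t ∈ Icc 0 T' := ⟨ha.trans ht.1.le, ht.2.trans hb⟩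
      have h1 : ‖histSegment Δ x t‖ ≤ r := norm_histSegment_le (hwin t htT) hr0.le fun s hs =>
        (hR _ (mem_image_of_mem _ ⟨by linarith [hs.1, htT.1], hs.2.trans htT.2⟩)).trans
          ((le_max_left _ _).trans (le_max_left _ _))
      exact hK _ _ _ ((norm_now_le _).trans h1) h1 ((hut htT).trans (le_max_right _ _))
    · intro t ht
      have htT : t ∈ Icc 0 T' := ⟨ha.trans ht.1, ht.2.trans hb⟩
      rw [hx.integral_eq t htT.1 ((EReal.coe_le_coe_iff.2 htT.2).trans_lt hT'),
        hx.integral_eq a ha ((EReal.coe_le_coe_iff.2 haT.2).trans_lt hT'), add_assoc,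
        intervalIntegral.integral_add_adjacent_intervals (hxi a haT)
          ((hxi a haT).symm.trans (hxi t htT))]
    · refine Eventually.of_forall fun t ht => ?_
      have htT : t ∈ Icc 0 T' := ⟨ha.trans ht.1, ht.2.trans hb⟩
      have hnow := histSegment_now (hwin t htT)
      have hcond : ρ (⨆ τ : Icc (-(Δ : ℝ)) 0, V (histSegment Δ x t τ)) ≤
          V (histSegment Δ x t).now := by
        have : Nonempty (Icc (-(Δ : ℝ)) 0) := ⟨⟨0, neg_nonpos.mpr Δ.coe_nonneg, le_rfl⟩⟩
        -- the supremum over the history segment is attained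
        obtain ⟨τ, -, hτ⟩ := isCompact_univ.exists_isMaxOn univ_nonempty
          (hV.continuous.comp (histSegment Δ x t).continuous).continuousOn
        have hle : (⨆ τ, V (histSegment Δ x t τ)) ≤ V (histSegment Δ x t τ) :=
          ciSup_le fun τ' => hτ (mem_univ τ')
        refine (hρ.strictMonoOn.monotoneOn (Real.iSup_nonneg fun _ => hVnn _) (hVnn _) hle).trans ?_
        rw [hnow, histSegment_apply (hwin t htT)]
        exact hraz t ht _ ⟨by linarith [τ.2.1], by linarith [τ.2.2]⟩
      have h1 := hdiss _ _ (u t) hcond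
      rw [hnow] at h1
      have h2 := hc p q hp (x t) (hpq t ht).1 (hpq t ht).2
      rw [closedLoop, hnow]
      linarith

end

/-! ### Global existence -/

lemma continuous_primitive_max {E : Type*} [NormedAddCommGroup E] [NormedSpace ℝ E] {g : ℝ → E}
    (hg : ∀ b, 0 ≤ b → IntervalIntegrable g volume 0 b) :
    Continuous fun t => ∫ τ in (0 : ℝ)..(max t 0), g τ := by
  have h1 : ContinuousOn (fun t => ∫ τ in (0 : ℝ)..t, g τ) (Ici 0) := by
    intro t ht
    have ht' : (0 : ℝ) ≤ t + 1 := by linarith [mem_Ici.1 ht]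
    have h2 := intervalIntegral.continuousOn_primitive_interval' (hg (t + 1) ht') left_mem_uIcc
    rw [uIcc_of_le ht'] at h2
    refine (h2 t ⟨ht, by linarith⟩).mono_of_mem_nhdsWithin ?_
    rw [← Ici_inter_Iic]
    exact inter_mem_nhdsWithin _ (Iic_mem_nhds (by linarith))
  exact h1.comp_continuous (by fun_prop) fun t => mem_Ici.2 (le_max_right _ _)

/-- Global existence for a causal functional differential equation whose right-hand side `Φ` is
bounded by, and Lipschitz with constant, a continuous function `l` of time. The solution is the
fixed point of the integral operator, which is a contraction for the supremum norm weighted by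
`exp (-4 ∫ l)`. -/
theorem exists_primitive_of_causal_lipschitz {E : Type*} [NormedAddCommGroup E] [NormedSpace ℝ E]
    [CompleteSpace E] (Φ : ℝ → C(ℝ, E) → E) (ξ : C(ℝ, E)) {l : ℝ → ℝ} (hl : Continuous l)
    (hl0 : ∀ t, 0 ≤ l t)
    (hmeas : ∀ X, AEStronglyMeasurable (fun t => Φ t X) (volume.restrict (Ici 0)))
    (hbound : ∀ᵐ t, 0 ≤ t → ∀ X, ‖Φ t X‖ ≤ l t)
    (hlip : ∀ᵐ t, 0 ≤ t → ∀ X Y D, (∀ s ≤ t, ‖X s - Y s‖ ≤ D) → ‖Φ t X - Φ t Y‖ ≤ l t * D) :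
    ∃ X : C(ℝ, E), (∀ t ≤ 0, X t = ξ t) ∧
      (∀ t, 0 ≤ t → IntervalIntegrable (fun τ => Φ τ X) volume 0 t) ∧
      ∀ t, 0 ≤ t → X t = ξ 0 + ∫ τ in (0 : ℝ)..t, Φ τ X := by
  have hli : ∀ a b, IntervalIntegrable l volume a b := fun a b => hl.intervalIntegrable a b
  have hΦi : ∀ X a b, 0 ≤ a → 0 ≤ b → IntervalIntegrable (fun τ => Φ τ X) volume a b := by
    intro X a b ha hb
    have hsub : uIoc a b ⊆ Ici 0 := fun t ht => (le_min ha hb).trans ht.1.le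
    refine (hli a b).mono_fun
      ((hmeas X).mono_measure (Measure.restrict_mono hsub le_rfl)) ?_
    refine (ae_restrict_iff' measurableSet_uIoc).2 ?_
    filter_upwards [hbound] with t h ht
    exact (h (hsub ht) X).trans (le_abs_self _)
  set A : ℝ → ℝ := fun t => ∫ τ in (0 : ℝ)..t, l τ with hA
  have hAd : ∀ t, HasDerivAt A (l t) t := fun t =>
    intervalIntegral.integral_hasDerivAt_right (hli _ _) (hl.stronglyMeasurableAtFilter _ _)
      hl.continuousAt
  have hAc : Continuous A := continuous_iff_continuousAt.2 fun t => (hAd t).continuousAt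
  have hA0 : A 0 = 0 := by simp [hA]
  have hAmono : Monotone A :=
    monotone_of_deriv_nonneg (fun t => (hAd t).differentiableAt) fun t => by
      rw [(hAd t).deriv]; exact hl0 t
  set w : ℝ → ℝ := fun t => Real.exp (4 * A t) with hw
  have hwc : Continuous w := by fun_prop
  have hw0 : w 0 = 1 := by simp [hw, hA0]
  have hwpos : ∀ t, 0 < w t := fun t => Real.exp_pos _
  have hwmono : Monotone w := fun s t h => Real.exp_le_exp.2 (by linarith [hAmono h])
  have hAw : ∀ t, A t ≤ w t := fun t => by
    have h1 := Real.add_one_le_exp (4 * A t)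
    change A t ≤ Real.exp (4 * A t)
    rcases le_total (A t) 0 with h | h <;> linarith [Real.exp_pos (4 * A t)]
  have hwd : ∀ t, HasDerivAt w (4 * l t * w t) t := fun t => by
    have := ((hAd t).const_mul 4).exp
    rwa [mul_comm] at this
  have hlw : ∀ t, ∫ τ in (0 : ℝ)..t, l τ * (2 * w τ) = (w t - 1) / 2 := fun t => by
    have h1 := intervalIntegral.integral_eq_sub_of_hasDerivAt (a := 0) (b := t)
      (fun s _ => hwd s) (Continuous.intervalIntegrable (by fun_prop) _ _)
    rw [hw0] at h1
    rw [← h1, ← intervalIntegral.integral_div]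
    congr 1
    ext τ
    ring
  -- the trajectory represented by the weighted unknown `z`; subtracting `z 0` makes it continuous
  -- at `0` for every `z`, at the cost of a factor `2`, which the factor `4` in `w` compensates
  let traj : BoundedContinuousFunction ℝ E → C(ℝ, E) := fun z =>
    ⟨fun t => ξ (min t 0) + w (max t 0) • z (max t 0) - z 0, by fun_prop⟩
  have htraj : ∀ z z' τ, 0 ≤ τ → ∀ s ≤ τ,
      ‖traj z s - traj z' s‖ ≤ 2 * w τ * dist z z' := by
    intro z z' τ hτ s hs
    have h1 : traj z s - traj z' s =
        w (max s 0) • (z (max s 0) - z' (max s 0)) - (z 0 - z' 0) := by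
      simp only [traj, ContinuousMap.coe_mk, smul_sub]
      abel
    have h2 : ∀ r, ‖z r - z' r‖ ≤ dist z z' := fun r => by
      rw [← dist_eq_norm]; exact BoundedContinuousFunction.dist_coe_le_dist r
    have h3 : w (max s 0) ≤ w τ := hwmono (max_le hs hτ)
    have h4 : 1 ≤ w τ := hw0 ▸ hwmono hτ
    have h5 : 0 ≤ dist z z' := dist_nonneg
    rw [h1]
    refine (norm_sub_le _ _).trans ?_
    rw [norm_smul, Real.norm_of_nonneg (hwpos _).le]
    calc _ ≤ w τ * dist z z' + 1 * dist z z' := by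
          rw [one_mul]
          exact add_le_add (mul_le_mul h3 (h2 _) (norm_nonneg _) (hwpos _).le) (h2 0)
      _ ≤ w τ * dist z z' + w τ * dist z z' := by gcongr
      _ = _ := by ring
  have hIc : ∀ X : C(ℝ, E), Continuous fun t => ∫ τ in (0 : ℝ)..(max t 0), Φ τ X := fun X =>
    continuous_primitive_max fun b hb => hΦi X 0 b le_rfl hb
  have hIb : ∀ (X : C(ℝ, E)) t, 0 ≤ t → ‖∫ τ in (0 : ℝ)..t, Φ τ X‖ ≤ A t := by
    intro X t ht
    refine intervalIntegral.norm_integral_le_of_norm_le ht ?_ (hli 0 t)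
    filter_upwards [hbound] with τ h hτ
    exact h hτ.1.le X
  have hPb : ∀ (X : C(ℝ, E)) t,
      ‖(w (max t 0))⁻¹ • ∫ τ in (0 : ℝ)..(max t 0), Φ τ X‖ ≤ 1 := by
    intro X t
    rw [norm_smul, Real.norm_of_nonneg (inv_nonneg.2 (hwpos _).le),
      inv_mul_le_iff₀ (hwpos _), mul_one]
    exact (hIb X _ (le_max_right _ _)).trans (hAw _)
  let P : BoundedContinuousFunction ℝ E → BoundedContinuousFunction ℝ E := fun z =>
    BoundedContinuousFunction.ofNormedAddCommGroup
      (fun t => (w (max t 0))⁻¹ • ∫ τ in (0 : ℝ)..(max t 0), Φ τ (traj z))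
      (((hwc.comp (by fun_prop)).inv₀ fun t => (hwpos _).ne').smul (hIc (traj z))) 1
      (hPb (traj z))
  have hP : ContractingWith (1 / 2 : ℝ≥0) P := by
    refine ⟨by norm_num [← NNReal.coe_lt_coe], LipschitzWith.of_dist_le_mul fun z z' => ?_⟩
    refine (BoundedContinuousFunction.dist_le (by positivity)).2 fun t => ?_
    have h0 : (0 : ℝ) ≤ max t 0 := le_max_right _ _
    set t' := max t 0 with ht'
    have h1 : P z t - P z' t =
        (w t')⁻¹ • ∫ τ in (0 : ℝ)..t', (Φ τ (traj z) - Φ τ (traj z')) := by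
      rw [intervalIntegral.integral_sub (hΦi _ _ _ le_rfl h0) (hΦi _ _ _ le_rfl h0), smul_sub]
      rfl
    have h2 : ‖∫ τ in (0 : ℝ)..t', (Φ τ (traj z) - Φ τ (traj z'))‖ ≤
        ∫ τ in (0 : ℝ)..t', l τ * (2 * w τ) * dist z z' := by
      refine intervalIntegral.norm_integral_le_of_norm_le h0 ?_
        (Continuous.intervalIntegrable (by fun_prop) _ _)
      filter_upwards [hlip] with τ h hτ
      rw [mul_assoc]
      exact h hτ.1.le _ _ _ (htraj z z' τ hτ.1.le)
    rw [intervalIntegral.integral_mul_const, hlw] at h2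
    rw [dist_eq_norm, h1, norm_smul, Real.norm_of_nonneg (inv_nonneg.2 (hwpos _).le),
      inv_mul_le_iff₀ (hwpos _)]
    refine h2.trans ?_
    push_cast
    have h3 : 0 ≤ dist z z' := dist_nonneg
    linarith
  obtain ⟨z, hz⟩ : ∃ z, P z = z := ⟨_, hP.fixedPoint_isFixedPt⟩
  have hz' : ∀ t, 0 ≤ t → w t • z t = ∫ τ in (0 : ℝ)..t, Φ τ (traj z) := by
    intro t ht
    have h1 : P z t = (w (max t 0))⁻¹ • ∫ τ in (0 : ℝ)..(max t 0), Φ τ (traj z) := rfl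
    rw [hz, max_eq_left ht] at h1
    rw [h1, smul_inv_smul₀ (hwpos t).ne']
  have hz0 : z 0 = 0 := by
    have := hz' 0 le_rfl
    rwa [hw0, one_smul, intervalIntegral.integral_same] at this
  refine ⟨traj z, fun t ht => ?_, fun t ht => hΦi _ _ _ le_rfl ht, fun t ht => ?_⟩
  · simp [traj, min_eq_left ht, max_eq_right ht, hz0]
  · rw [← hz' t ht]
    simp [traj, min_eq_right ht, max_eq_left ht, hz0]

/-- Coordinatewise truncation of a vector to the cube `[-r, r]ⁿ`. -/
noncomputable def truncate {n : ℕ} (r : ℝ) (x : Vec n) : Vec n :=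
  WithLp.toLp 2 fun i => max (-r) (min r (x i))

lemma continuous_truncate {n : ℕ} : Continuous fun p : ℝ × Vec n => truncate p.1 p.2 := by
  refine (PiLp.continuous_toLp 2 _).comp (continuous_pi fun i => ?_)
  fun_prop

lemma norm_truncate_sub_le {n : ℕ} (r : ℝ) (x y : Vec n) :
    ‖truncate r x - truncate r y‖ ≤ ‖x - y‖ := by
  rw [EuclideanSpace.norm_eq, EuclideanSpace.norm_eq]
  refine Real.sqrt_le_sqrt (Finset.sum_le_sum fun i _ => ?_)
  refine pow_le_pow_left₀ (norm_nonneg _) ?_ 2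
  simp only [truncate, PiLp.sub_apply, Real.norm_eq_abs]
  refine (abs_max_sub_max_le_max _ _ _ _).trans (max_le (by simp) ?_)
  exact (abs_min_sub_min_le_max _ _ _ _).trans (max_le (by simp) le_rfl)

lemma norm_truncate_le {n : ℕ} {r : ℝ} (hr : 0 ≤ r) (x : Vec n) :
    ‖truncate r x‖ ≤ √n * r := by
  have h : ∀ i, ‖truncate r x i‖ ^ 2 ≤ r ^ 2 := fun i => by
    refine pow_le_pow_left₀ (norm_nonneg _) (abs_le.2 ⟨le_max_left _ _, ?_⟩) 2
    exact max_le (by linarith) (min_le_left _ _)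
  rw [EuclideanSpace.norm_eq]
  calc _ ≤ √(∑ _i : Fin n, r ^ 2) := Real.sqrt_le_sqrt (Finset.sum_le_sum fun i _ => h i)
    _ = √n * r := by
      rw [Finset.sum_const, Finset.card_univ, Fintype.card_fin, nsmul_eq_mul,
        Real.sqrt_mul (Nat.cast_nonneg n), Real.sqrt_sq hr]

lemma truncate_eq_self {n : ℕ} {r : ℝ} {x : Vec n} (h : ‖x‖ ≤ r) : truncate r x = x := by
  ext i
  have h1 := abs_le.1 ((PiLp.norm_apply_le x i).trans h)
  simp [truncate, h1.1, h1.2]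

section

variable {Δ : ℝ≥0} {n m : ℕ} {F : Vec n → Hist Δ n → Vec m → Vec n}

lemma LipschitzOnBoundedSets.continuous (hF : LipschitzOnBoundedSets F) :
    Continuous fun p : Vec n × Hist Δ n × Vec m => F p.1 p.2.1 p.2.2 := by
  refine continuous_iff_continuousAt.2 fun p => ?_
  obtain ⟨L, hL, h⟩ := hF (‖p‖ + 1) (by positivity)
  rw [ContinuousAt, tendsto_iff_norm_sub_tendsto_zero]
  have hlim : Tendsto (fun q : Vec n × Hist Δ n × Vec m =>
      L * (‖q.1 - p.1‖ + ‖q.2.1 - p.2.1‖ + ‖q.2.2 - p.2.2‖)) (𝓝 p) (𝓝 0) := by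
    have : Continuous fun q : Vec n × Hist Δ n × Vec m =>
      L * (‖q.1 - p.1‖ + ‖q.2.1 - p.2.1‖ + ‖q.2.2 - p.2.2‖) := by fun_prop
    simpa using this.tendsto p
  have hnear : ∀ᶠ q in 𝓝 p, ‖q‖ ≤ ‖p‖ + 1 :=
    continuous_norm.continuousAt.eventually (ge_mem_nhds (by linarith))
  have hcomp : ∀ q : Vec n × Hist Δ n × Vec m, ‖q‖ ≤ ‖p‖ + 1 →
      ‖q.1‖ ≤ ‖p‖ + 1 ∧ ‖q.2.1‖ ≤ ‖p‖ + 1 ∧ ‖q.2.2‖ ≤ ‖p‖ + 1 := fun q hq =>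
    ⟨(norm_fst_le q).trans hq, ((norm_fst_le q.2).trans (norm_snd_le q)).trans hq,
      ((norm_snd_le q.2).trans (norm_snd_le q)).trans hq⟩
  refine squeeze_zero' (Eventually.of_forall fun _ => norm_nonneg _) ?_ hlim
  filter_upwards [hnear] with q hq
  obtain ⟨a1, a2, a3⟩ := hcomp q hq
  obtain ⟨b1, b2, b3⟩ := hcomp p (by linarith)
  exact h _ _ _ _ _ _ a1 b1 a2 b2 a3 b3

lemma continuous_histSegment {x : ℝ → Vec n} (hx : Continuous x) :
    Continuous (histSegment Δ x) := by
  let f : C(ℝ × Icc (-(Δ : ℝ)) 0, Vec n) := ⟨fun p => x (p.1 + p.2), by fun_prop⟩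
  have : histSegment Δ x = f.curry := by
    ext t τ : 2
    rw [histSegment_apply hx.continuousOn]
    rfl
  rw [this]
  exact f.curry.continuous

/-- A locally essentially bounded input is almost everywhere below a continuous function. -/
lemma IsInput.exists_continuous_bound {u : ℝ → Vec m} (hu : IsInput u) :
    ∃ b : ℝ → ℝ, Continuous b ∧ ∀ᵐ t, 0 ≤ t → ‖u t‖ ≤ b t := by
  choose C hC0 hC using fun k : ℕ => hu.exists_bound k
  obtain ⟨b, hb⟩ := exists_continuous_forall_mem_convex_of_local_const
    (t := fun t : ℝ => {c : ℝ | ∃ k : ℕ, t ≤ k ∧ C k ≤ c})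
    (fun t => OrdConnected.convex <| IsUpperSet.ordConnected <| by
      rintro c d hcd ⟨k, h1, h2⟩
      exact ⟨k, h1, h2.trans hcd⟩)
    (fun t => by
      obtain ⟨k, hk⟩ := exists_nat_gt t
      exact ⟨C k, (eventually_lt_nhds hk).mono fun y hy => ⟨k, hy.le, le_rfl⟩⟩)
  refine ⟨b, b.continuous, ?_⟩
  filter_upwards [ae_all_iff.2 hC] with t ht ht0
  obtain ⟨k, h1, h2⟩ := hb t
  exact (ht k ⟨ht0, h1⟩).trans h2

/-- On balls of continuously varying radius `r t`, bounds and Lipschitz constants of `F` can be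
chosen to depend continuously on `t`. -/
lemma LipschitzOnBoundedSets.exists_continuous_bound (hF : LipschitzOnBoundedSets F)
    (hF0 : F 0 0 0 = 0) {r : ℝ → ℝ} (hr : Continuous r) :
    ∃ l : ℝ → ℝ, Continuous l ∧ ∀ t, 0 ≤ l t ∧ ∀ φ₁ φ₂ v, ‖φ₁‖ ≤ r t → ‖φ₂‖ ≤ r t → ‖v‖ ≤ r t →
      ‖closedLoop F φ₁ v‖ ≤ l t ∧
        ‖closedLoop F φ₁ v - closedLoop F φ₂ v‖ ≤ l t * ‖φ₁ - φ₂‖ := by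
  obtain ⟨l, hl⟩ := exists_continuous_forall_mem_convex_of_local_const
    (t := fun t : ℝ => {c : ℝ | 0 ≤ c ∧ ∀ φ₁ φ₂ v, ‖φ₁‖ ≤ r t → ‖φ₂‖ ≤ r t → ‖v‖ ≤ r t →
      ‖closedLoop F φ₁ v‖ ≤ c ∧ ‖closedLoop F φ₁ v - closedLoop F φ₂ v‖ ≤ c * ‖φ₁ - φ₂‖})
    (fun t => OrdConnected.convex <| IsUpperSet.ordConnected <| by
      rintro c d hcd ⟨h0, h⟩
      exact ⟨h0.trans hcd, fun φ₁ φ₂ v h1 h2 h3 => ⟨(h φ₁ φ₂ v h1 h2 h3).1.trans hcd,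
        (h φ₁ φ₂ v h1 h2 h3).2.trans (by gcongr)⟩⟩)
    (fun t => by
      have hp : 0 < |r t| + 1 := by positivity
      obtain ⟨L, hL, h⟩ := hF _ hp
      obtain ⟨K, hK0, hK⟩ := hF.exists_bound hF0 hp
      refine ⟨max (2 * L) K, ?_⟩
      have : ∀ᶠ y in 𝓝 t, r y < |r t| + 1 :=
        hr.continuousAt.eventually (gt_mem_nhds (by linarith [le_abs_self (r t)]))
      filter_upwards [this] with y hy
      refine ⟨hK0.trans (le_max_right _ _), fun φ₁ φ₂ v h1 h2 h3 => ⟨?_, ?_⟩⟩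
      · exact (hK _ _ _ ((norm_now_le φ₁).trans (h1.trans hy.le)) (h1.trans hy.le)
          (h3.trans hy.le)).trans (le_max_right _ _)
      · refine (h _ _ φ₁ φ₂ v v ((norm_now_le φ₁).trans (h1.trans hy.le))
          ((norm_now_le φ₂).trans (h2.trans hy.le)) (h1.trans hy.le) (h2.trans hy.le)
          (h3.trans hy.le) (h3.trans hy.le)).trans ?_
        have h4 : ‖φ₁.now - φ₂.now‖ ≤ ‖φ₁ - φ₂‖ := norm_now_le (φ₁ - φ₂)
        rw [sub_self, norm_zero, add_zero]
        calc _ ≤ L * (‖φ₁ - φ₂‖ + ‖φ₁ - φ₂‖) := by gcongr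
          _ = 2 * L * ‖φ₁ - φ₂‖ := by ring
          _ ≤ _ := by gcongr; exact le_max_left _ _)
  exact ⟨l, l.continuous, hl⟩

/-- If all solutions obey an a priori bound `R₀`, then there is a global solution. The equation is
solved for trajectories truncated just outside the bound; the truncated solution can never leave
the region where the truncation is inactive. -/
theorem exists_isSolution_top (hF : LipschitzOnBoundedSets F) (hF0 : F 0 0 0 = 0)
    {u : ℝ → Vec m} (hu : IsInput u) (x₀ : Hist Δ n) {R₀ : ℝ → ℝ} (hR₀c : Continuous R₀)
    (hR₀m : Monotone R₀)
    (hprior : ∀ T x, IsSolution (closedLoop F) x₀ u T x → ∀ t : ℝ, 0 ≤ t → (t : EReal) < T →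
      ‖x t‖ ≤ R₀ t) :
    ∃ x, IsSolution (closedLoop F) x₀ u ⊤ x := by
  set R : ℝ → ℝ := fun t => max (R₀ t) ‖x₀‖ + 1 with hR
  have hRc : Continuous R := by fun_prop
  have hRm : Monotone R := fun s t h => add_le_add_left (max_le_max_right _ (hR₀m h)) 1
  have hRx : ∀ t, ‖x₀‖ < R t := fun t => (le_max_right _ _).trans_lt (lt_add_one _)
  have hRR : ∀ t, R₀ t < R t := fun t => (le_max_left _ _).trans_lt (lt_add_one _)
  have hR0 : ∀ t, 0 ≤ R t := fun t => (norm_nonneg _).trans (hRx t).le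
  obtain ⟨b, hbc, hb⟩ := hu.exists_continuous_bound
  obtain ⟨l, hlc, hl⟩ := hF.exists_continuous_bound hF0
    (r := fun t => max (√n * R t) (b t)) (by fun_prop)
  have hΔ : -(Δ : ℝ) ≤ 0 := neg_nonpos.2 Δ.coe_nonneg
  let tr : C(ℝ, Vec n) → ℝ → Vec n := fun X s => truncate (R s) (X s)
  have htrc : ∀ X, Continuous (tr X) := fun X =>
    continuous_truncate.comp (hRc.prodMk X.continuous)
  have htrn : ∀ X t, ‖histSegment Δ (tr X) t‖ ≤ √n * R t := fun X t =>
    norm_histSegment_le (htrc X).continuousOn (mul_nonneg (Real.sqrt_nonneg _) (hR0 t))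
      fun s hs => (norm_truncate_le (hR0 s) _).trans
        (mul_le_mul_of_nonneg_left (hRm hs.2) (Real.sqrt_nonneg _))
  let ξ : C(ℝ, Vec n) := ⟨fun t => x₀ (projIcc _ _ hΔ t), by fun_prop⟩
  obtain ⟨X, hX0, hXi, hX⟩ := exists_primitive_of_causal_lipschitz
    (fun t X => closedLoop F (histSegment Δ (tr X) t) (u t)) ξ hlc (fun t => (hl t).1)
    (fun X => by
      have h1 := continuous_histSegment (Δ := Δ) (htrc X)
      have h2 : Continuous fun t => (histSegment Δ (tr X) t).now :=
        (continuous_eval_const _).comp h1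
      exact hF.continuous.comp_aestronglyMeasurable
        (h2.aestronglyMeasurable.prodMk (h1.aestronglyMeasurable.prodMk hu.aestronglyMeasurable)))
    (by
      filter_upwards [hb] with t hbt ht X
      exact ((hl t).2 _ 0 _ ((htrn X t).trans (le_max_left _ _))
        (by simpa using Or.inl (mul_nonneg (Real.sqrt_nonneg _) (hR0 t)))
        ((hbt ht).trans (le_max_right _ _))).1)
    (by
      filter_upwards [hb] with t hbt ht X Y D hD
      refine ((hl t).2 _ _ _ ((htrn X t).trans (le_max_left _ _))
        ((htrn Y t).trans (le_max_left _ _)) ((hbt ht).trans (le_max_right _ _))).2.trans ?_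
      refine mul_le_mul_of_nonneg_left ?_ (hl t).1
      refine (ContinuousMap.norm_le _ ((norm_nonneg _).trans (hD t le_rfl))).2 fun τ => ?_
      rw [ContinuousMap.sub_apply, histSegment_apply (htrc X).continuousOn,
        histSegment_apply (htrc Y).continuousOn]
      exact (norm_truncate_sub_le _ _ _).trans (hD _ (by linarith [τ.2.2])))
  have hξ0 : ξ 0 = x₀.now := by
    simp only [ξ, ContinuousMap.coe_mk, Hist.now]
    congr 1
    exact projIcc_of_mem hΔ ⟨hΔ, le_rfl⟩
  have hneg : ∀ t ≤ 0, ‖X t‖ < R t := fun t ht => by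
    rw [hX0 t ht]
    exact (x₀.norm_coe_le_norm _).trans_lt (hRx t)
  -- as long as the truncation is inactive, `X` solves the original equation
  have hsol : ∀ T : EReal, 0 < T → (∀ t : ℝ, (t : EReal) < T → ‖X t‖ < R t) →
      IsSolution (closedLoop F) x₀ u T X := by
    intro T hT hlt
    have hseg : ∀ t : ℝ, (t : EReal) < T → histSegment Δ (tr X) t = histSegment Δ X t := by
      intro t ht
      ext τ : 1
      rw [histSegment_apply (htrc X).continuousOn, histSegment_apply X.continuous.continuousOn]
      refine truncate_eq_self (hlt _ (lt_of_le_of_lt ?_ ht)).le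
      exact EReal.coe_le_coe_iff.2 (by linarith [τ.2.2])
    have hcongr : ∀ t : ℝ, 0 ≤ t → (t : EReal) < T → ∀ τ ∈ Icc 0 t,
        closedLoop F (histSegment Δ (tr X) τ) (u τ) = closedLoop F (histSegment Δ X τ) (u τ) :=
      fun t _ htT τ hτ => by rw [hseg τ ((EReal.coe_le_coe_iff.2 hτ.2).trans_lt htT)]
    refine ⟨hT, X.continuous.continuousOn, fun τ => ?_, fun t ht htT => ?_, fun t ht htT => ?_⟩
    · rw [hX0 _ τ.2.2]
      simp only [ξ, ContinuousMap.coe_mk]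
      rw [projIcc_val]
    · refine (hXi t ht).congr fun τ hτ => ?_
      rw [uIoc_of_le ht] at hτ
      exact hcongr t ht htT τ (Ioc_subset_Icc_self hτ)
    · rw [hX t ht, hξ0]
      congr 1
      refine intervalIntegral.integral_congr fun τ hτ => ?_
      rw [uIcc_of_le ht] at hτ
      exact hcongr t ht htT τ hτ
  refine ⟨X, hsol ⊤ EReal.zero_lt_top fun t _ => ?_⟩
  by_contra! hcon
  -- the first time at which the truncation radius is reached
  set S := {s : ℝ | R s ≤ ‖X s‖} with hS
  have hSclosed : IsClosed S := isClosed_le hRc X.continuous.norm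
  have hSpos : ∀ s ∈ S, 0 < s := fun s hs => by
    by_contra! h
    exact absurd hs (not_le.2 (hneg s h))
  have hSbdd : BddBelow S := ⟨0, fun s hs => (hSpos s hs).le⟩
  have hmem : sInf S ∈ S := hSclosed.csInf_mem ⟨t, hcon⟩ hSbdd
  set T := sInf S with hT
  have hT0 : 0 < T := hSpos T hmem
  have hlt : ∀ s < T, ‖X s‖ < R s := fun s hs => by
    by_contra! h
    exact absurd (csInf_le hSbdd h) (not_le.2 hs)
  have hsolT := hsol T (EReal.coe_pos.2 hT0) fun s hs => hlt s (EReal.coe_lt_coe_iff.1 hs)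
  have hle : ‖X T‖ ≤ R₀ T := by
    refine le_of_tendsto_of_tendsto (b := 𝓝[<] T)
      X.continuous.norm.continuousAt.continuousWithinAt
      hR₀c.continuousAt.continuousWithinAt ?_
    filter_upwards [Ioo_mem_nhdsLT hT0] with s hs
    exact hprior T X hsolT s hs.1.le (EReal.coe_lt_coe_iff.2 hs.2)
  exact absurd (hle.trans_lt (hRR T)) (not_lt.2 hmem)

end

/-! ### Integral input-to-state stability -/

section

variable {n : ℕ} {V : Vec n → ℝ}

/-- Sublevel sets of a positive definite, radially unbounded function control the norm. -/
lemma exists_classK_norm_le (hV : Continuous V) (hVnn : ∀ x, 0 ≤ V x)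
    (hVpos : ∀ x, x ≠ 0 → 0 < V x)
    (hVunb : Tendsto V (Bornology.cobounded (Vec n)) atTop) :
    ∃ ψ : ℝ → ℝ, ClassK ψ ∧ ∀ x, ‖x‖ ≤ ψ (V x) := by
  refine exists_classK_majorant V norm hVnn (exists_norm_le_of_le_level hVunb) fun ε hε => ?_
  set S := {x : Vec n | V x ≤ 1 ∧ ε ≤ ‖x‖} with hS
  have hcompact : IsCompact S := by
    obtain ⟨C, hC⟩ := exists_norm_le_of_le_level hVunb 1
    refine Metric.isCompact_of_isClosed_isBounded ?_
      ((Metric.isBounded_closedBall (x := 0) (r := C)).subset fun x hx => ?_)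
    · exact (isClosed_le hV continuous_const).inter (isClosed_le continuous_const continuous_norm)
    · simpa using hC x hx.1
  rcases S.eq_empty_or_nonempty with hempty | hne
  · refine ⟨1, one_pos, fun x hx => ?_⟩
    by_contra! hcon
    have : x ∈ S := ⟨hx, hcon.le⟩
    rw [hempty] at this
    exact this
  · obtain ⟨x₀, hx₀, hmin⟩ := hcompact.exists_isMinOn hne hV.continuousOn
    have hx₀pos : 0 < V x₀ := hVpos x₀ (norm_pos_iff.1 (hε.trans_le hx₀.2))
    refine ⟨min 1 (V x₀ / 2), by positivity, fun x hx => ?_⟩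
    by_contra! hcon
    have h1 : V x₀ ≤ V x := hmin ⟨hx.trans (min_le_left _ _), hcon.le⟩
    linarith [hx.trans (min_le_right _ _)]

lemma exists_classK_le_norm (hV : Continuous V) (hV0 : V 0 = 0) :
    ∃ ω : ℝ → ℝ, ClassK ω ∧ ∀ x, V x ≤ ω ‖x‖ := by
  refine exists_classK_majorant (fun x : Vec n => ‖x‖) V (fun x => norm_nonneg x)
    (fun R => ?_) fun ε hε => ?_
  · obtain ⟨C, hC⟩ := (isCompact_closedBall (0 : Vec n) R).bddAbove_image hV.continuousOn
    exact ⟨C, fun x hx => hC (mem_image_of_mem _ (by simpa using hx))⟩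
  · have h := hV.continuousAt (x := (0 : Vec n))
    rw [ContinuousAt, hV0] at h
    obtain ⟨δ, hδ, hball⟩ := Metric.eventually_nhds_iff.1 (h.eventually (ge_mem_nhds hε))
    exact ⟨δ / 2, half_pos hδ, fun x hx => hball (by rw [dist_zero_right]; linarith)⟩

end

end TimeDelay

open TimeDelay in
theorem mainTheorem1 (n m : ℕ) (Δ : ℝ≥0)
    (F : TimeDelay.Vec n → TimeDelay.Hist Δ n → TimeDelay.Vec m → TimeDelay.Vec n)
    (hF : TimeDelay.LipschitzOnBoundedSets F) (hF0 : F 0 0 0 = 0)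
    (V : TimeDelay.Vec n → ℝ) (hV : ContDiff ℝ 1 V)
    (hV0 : V 0 = 0) (hVpos : ∀ x, x ≠ 0 → 0 < V x)
    (hVunb : Tendsto V (Bornology.cobounded (TimeDelay.Vec n)) atTop)
    (α γ ρ κ : ℝ → ℝ)
    (hα : TimeDelay.ClassP α) (hγ : TimeDelay.ClassN γ)
    (hρ : TimeDelay.ClassKInf ρ) (hκ : TimeDelay.ClassKInf κ)
    (hdiss : ∀ (φ w : TimeDelay.Hist Δ n) (v : TimeDelay.Vec m),
      ρ (⨆ τ : Icc (-(Δ : ℝ)) 0, V (w τ)) ≤ V φ.now →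
        inner ℝ (gradient V φ.now) (F φ.now w v) ≤ -α ‖φ.now‖ + γ ‖v‖)
    (hgain : ∀ s : ℝ, 0 ≤ s → ρ s + κ (ρ s) ≤ s) :
    TimeDelay.IsIISS (TimeDelay.closedLoop F) := by
  have hVnn : ∀ x, 0 ≤ V x := fun x => by
    rcases eq_or_ne x 0 with rfl | hx
    · exact hV0.ge
    · exact (hVpos x hx).le
  have hΔ : (0 : ℝ) ≤ Δ := Δ.coe_nonneg
  obtain ⟨ψ, hψK, hψ⟩ := exists_classK_norm_le hV.continuous hVnn hVpos hVunb
  obtain ⟨ω, hωK, hω⟩ := exists_classK_le_norm hV.continuous hV0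
  obtain ⟨σ, hσ, hlevel⟩ := exists_classN_level hρ hκ
  have hψN := hψK.classN
  have hωN := hωK.classN
  have hrate : ∀ p q : ℝ, ∃ c, 0 < p → 0 < c ∧ ∀ x, p ≤ V x → V x ≤ q → c ≤ α ‖x‖ := by
    intro p q
    by_cases hp : 0 < p
    · obtain ⟨c, hc⟩ := exists_pos_le_of_mem_levels hV.continuous hV0 hVunb hα hp q
      exact ⟨c, fun _ => hc⟩
    · exact ⟨0, fun h => absurd h hp⟩
  choose c hc using hrate
  have hρlt : ∀ s, 0 < s → ρ s < s := fun s hs => by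
    linarith [hgain s hs.le, hκ.pos _ (hρ.pos s hs)]
  -- the overshoot above which the energy is absorbed by the gain margin
  set η₁ : ℝ → ℝ := fun s => σ s + 2 * s with hη₁
  have hη₁N : ClassN η₁ := hσ.add (classN_const_mul zero_le_two)
  set E : (ℝ → Vec m) → ℝ → ℝ := fun u t => ∫ τ in (0 : ℝ)..t, γ ‖u τ‖ with hE
  have hE0 : ∀ u t, 0 ≤ t → 0 ≤ E u t := fun u t ht =>
    intervalIntegral.integral_nonneg ht fun τ _ => hγ.nonneg (norm_nonneg _)
  have hdecay : ∀ {x₀ u T x}, IsInput u → IsSolution (closedLoop F) x₀ u T x → ∀ t : ℝ, 0 ≤ t →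
      (t : EReal) < T → RazumikhinDecay Δ t ρ c (fun t => V (x t)) (E u) :=
    fun hu hx t ht htT => hx.razumikhinDecay hF hF0 hV hVnn hγ hρ
      (fun p q hp => (hc p q hp).2) hdiss hu ht htT
  have hinit : ∀ {x₀ : Hist Δ n} {u T x}, IsSolution (closedLoop F) x₀ u T x →
      ∀ s ∈ Icc (-(Δ : ℝ)) 0, V (x s) ≤ ω ‖x₀‖ := fun {x₀ u T x} hx s hs => by
    rw [hx.initial ⟨s, hs⟩]
    exact (hω _).trans (hωN.monotoneOn (norm_nonneg _) (norm_nonneg _) (x₀.norm_coe_le_norm _))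
  have hbase : ∀ {x₀ u T x}, IsInput u → IsSolution (closedLoop F) x₀ u T x → ∀ t : ℝ, 0 ≤ t →
      (t : EReal) < T → V (x t) ≤ ω ‖x₀‖ + E u t := fun hu hx t ht htT =>
    (hdecay hu hx t ht htT).le_add_energy hΔ (fun p q hp _ => (hc p q hp).1) hρ hρlt
      (hinit hx) ⟨ht, le_rfl⟩
  -- all pairs of a solution and a time
  let ι := {i : Hist Δ n × (ℝ → Vec m) × (ℝ → Vec n) × ℝ // IsInput i.2.1 ∧ 0 ≤ i.2.2.2 ∧
    ∃ T : EReal, (i.2.2.2 : EReal) < T ∧ IsSolution (closedLoop F) i.1 i.2.1 T i.2.2.1}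
  let exc : ι → ℝ := fun i => max 0 (V (i.1.2.2.1 i.1.2.2.2) - η₁ (E i.1.2.1 i.1.2.2.2))
  have hexc0 : ∀ i, 0 ≤ exc i := fun i => le_max_left _ _
  have hexcω : ∀ i : ι, exc i ≤ ω ‖i.1.1‖ := by
    rintro ⟨⟨x₀, u, x, t⟩, hu, ht, T, htT, hx⟩
    refine max_le (hωN.nonneg (norm_nonneg _)) ?_
    have h1 := hbase hu hx t ht htT
    have h2 := hE0 u t ht
    have h3 := hσ.nonneg h2
    simp only [hη₁] at h1 h2 h3 ⊢
    linarith
  have hψmono : ∀ {a b}, 0 ≤ a → a ≤ b → ψ (2 * a) ≤ ψ (2 * b) := fun {a b} ha hab =>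
    hψN.monotoneOn (show 0 ≤ 2 * a by linarith) (show 0 ≤ 2 * b by linarith) (by linarith)
  have hωmono : ∀ {a b}, 0 ≤ a → a ≤ b → ω a ≤ ω b := fun ha hab =>
    hωN.monotoneOn ha (ha.trans hab) hab
  obtain ⟨β, hβ, hle⟩ : ∃ β : ℝ → ℝ → ℝ, ClassKL β ∧
      ∀ i : ι, ψ (2 * exc i) ≤ β ‖i.1.1‖ i.1.2.2.2 := by
    refine exists_classKL_majorant _ _ _ (fun i => norm_nonneg _) (fun R => ?_)
      (fun ε hε => ?_) (fun R ε hε => ?_)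
    · exact ⟨ψ (2 * ω R), fun i hi =>
        hψmono (hexc0 i) ((hexcω i).trans (hωmono (norm_nonneg _) hi))⟩
    · obtain ⟨δ, hδ, h⟩ := (hψN.comp ((classN_const_mul zero_le_two).comp hωN)).exists_le hε
      exact ⟨δ, hδ, fun i hi =>
        (hψmono (hexc0 i) ((hexcω i).trans (hωmono (norm_nonneg _) hi))).trans h⟩
    · obtain ⟨δ, hδ, h⟩ := (hψN.comp (classN_const_mul zero_le_two)).exists_le hε
      obtain ⟨Θ, hΘ⟩ := exists_time_le_of_razumikhinDecay hΔ (fun p q hp _ => (hc p q hp).1)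
        hρ hκ hgain hσ hlevel (ω R) δ hδ
      refine ⟨Θ, ?_⟩
      rintro ⟨⟨x₀, u, x, t⟩, hu, ht, T, htT, hx⟩ hR ht'
      refine (hψmono (hexc0 _) (max_le hδ.le ?_)).trans h
      have := hΘ t _ _ _ (hdecay hu hx t ht htT) ht ht' (hωmono (norm_nonneg _) hR) (hinit hx)
      simp only [hη₁] at this ⊢
      linarith
  refine ⟨β, fun s => ψ (2 * η₁ s), γ, hβ,
    hψN.comp ((classN_const_mul zero_le_two).comp hη₁N), hγ, fun x₀ u hu => ⟨?_, ?_⟩⟩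
  · have hEi : ∀ b, 0 ≤ b → IntervalIntegrable (fun t => γ ‖u t‖) volume 0 b := fun b hb =>
      hu.intervalIntegrable hγ le_rfl hb
    have hpos : ∀ t, 0 ≤ ω ‖x₀‖ + E u (max t 0) := fun t =>
      add_nonneg (hωN.nonneg (norm_nonneg _)) (hE0 u _ (le_max_right _ _))
    refine exists_isSolution_top hF hF0 hu x₀ (R₀ := fun t => ψ (ω ‖x₀‖ + E u (max t 0)))
      ?_ ?_ ?_
    · exact hψN.continuousOn.comp_continuous
        (continuous_const.add (continuous_primitive_max hEi)) hpos
    · intro s t hst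
      refine hψN.monotoneOn (hpos s) (hpos t) (add_le_add_right ?_ _)
      have h1 : max s 0 ≤ max t 0 := max_le_max_right _ hst
      rw [← sub_nonneg, intervalIntegral.integral_interval_sub_left (hEi _ (le_max_right _ _))
        (hEi _ (le_max_right _ _))]
      exact intervalIntegral.integral_nonneg h1 fun τ _ => hγ.nonneg (norm_nonneg _)
    · intro T x hx t ht htT
      have h1 := hbase hu hx t ht htT
      rw [max_eq_left ht]
      exact (hψ _).trans (hψN.monotoneOn (hVnn _) ((hVnn _).trans h1) h1)
  · intro T x hx t ht htT
    have h1 := hle ⟨(x₀, u, x, t), hu, ht, T, htT, hx⟩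
    refine (hψ (x t)).trans ((hψN.le_add_of_le (hVnn _) (hexc0 ⟨(x₀, u, x, t), hu, ht, T, htT, hx⟩)
      (hη₁N.nonneg (hE0 u t ht)) ?_).trans (add_le_add_left h1 _))
    have := le_max_right 0 (V (x t) - η₁ (E u t))
    simp only [exc]
    linarith
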